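/- Let $\mathbb T^l=\mathbb R^l/\mathbb Z^l$, let $M\subset\mathbb R^m$ be open, and let $n\ge 1$. Consider the family of maps $f=f_\kappa$, $$\theta'=\theta+\omega_0+\kappa F(\theta,J;\kappa),\qquad J'=J+\kappa G(\theta,J;\kappa),\qquad (\theta,J)\in\mathbb T^l\times M,$$ where $F,G$ are real analytic in $(\theta,J,\kappa)$ in a neighbourhood of $\mathbb T^l\times M\times\{0\}$, and $\omega_0\in\mathbb R^l$ is Diophantine: there are $c,\mu>0$ with $|k\cdot\omega_0-p|\ge c|k|^{-\mu}$ for all $k\in\mathbb Z^l\setminus\{0\}$, $p\in\mathbb Z$. For a function $H(\theta,J;\kappa)$ write $\bar H(J)=\int_{\mathbb T^l}H(\theta,J;0)\,d\theta$. A *sequence of $n$ decoupling transformations* consists of functions $F^{(j)},G^{(j)}$ ($1\le j\le n+1$), real analytic in $(\theta,J,\kappa)$ in a neighbourhood of $\mathbb T^l\times M\times\{0\}$, with $F^{(1)}=F$, $G^{(1)}=G$, and functions $T^{(j)},S^{(j)}$ ($1\le j\le n$), real analytic on $\mathbb T^l\times M$, such that for each $1\le j\le n$ the transformation $(\psi,I)\mapsto(\theta,J)=(\psi+\kappa^jT^{(j)}(\psi,I),\,I+\kappa^jS^{(j)}(\psi,I))$,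 whose inverse is denoted $h^{(j)}$, conjugates $$\theta'=\theta+\omega_0+\sum_{i=1}^{j-1}\kappa^i\bar F^{(i)}(J)+\kappa^jF^{(j)}(\theta,J;\kappa),\quad J'=J+\sum_{i=1}^{j-1}\kappa^i\bar G^{(i)}(J)+\kappa^jG^{(j)}(\theta,J;\kappa)$$ to the map of the same form (in the variables $(\psi,I)$) with $j+1$ in place of $j$; that is, on $\mathbb T^l\times K$ for each compact $K\subset M$ and all sufficiently small $|\kappa|$ (depending on $K$). Then such sequences exist. Moreover, let any such sequence be given, let $V$ be open with compact closure $\overline V\subset M$, let $K\subset V$ be compact and let $T>0$. There are $\kappa_0>0$ and $C$ such that: 1. For $|\kappa|<\kappa_0$ the composition $h^{-1}=(h^{(1)})^{-1}\circ\dots\circ(h^{(n)})^{-1}$ is an analytic diffeomorphism of $\mathbb T^l\times V$ onto an open set $W_\kappa$; let $h=h^{(n)}\circ\dots\circ h^{(1)}:W_\kappa\to\mathbb T^l\times V$ be its inverse and let $\pi(\psi,I)=I$. 2. Let $0<\kappa<\kappa_0$, let $(\theta_0,J_0)\in W_\kappa$, and let $\bar I^{(n+1)}_t$ be the orbit of the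 averaged map truncated at order $n+1$, $$\bar I'=\bar I+\sum_{j=1}^{n+1}\kappa^j\bar G^{(j)}(\bar I),\qquad \bar I^{(n+1)}_0=\pi h(\theta_0,J_0).$$ If $\bar I^{(n+1)}_t\in K$ for all integers $0\le t<T/\kappa$, then for all integers $0\le t<T/\kappa$ the orbit $(\theta_t,J_t)$ of $f$ stays in $\mathbb T^l\times M$ and in $W_\kappa$, and $$|\pi h(\theta_t,J_t)-\bar I^{(n+1)}_t|\le C\kappa^{n+1}.$$ Thus only $n$ decoupling transformations enter; $h^{(n+1)}$ is not needed. -/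

import Mathlib

open Set MeasureTheory

namespace SlowFast

/-- Fast angles, lifted from the torus `ℝ^l / ℤ^l` to `ℝ^l`. -/
abbrev Angle (l : ℕ) : Type := Fin l → ℝ

/-- Slow variables. -/
abbrev Slow (m : ℕ) : Type := EuclideanSpace ℝ (Fin m)

/-- `ω` is Diophantine: for some `c, μ > 0`, `|k ⬝ ω - p| ≥ c |k|^(-μ)` for all integer vectors
`k ≠ 0` and all integers `p`, where `|k|` is the maximum norm. -/
def IsDiophantine {l : ℕ} (ω : Angle l) : Prop :=
  ∃ c μ : ℝ, 0 < c ∧ 0 < μ ∧ ∀ k : Fin l → ℤ, k ≠ 0 → ∀ p : ℤ,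
    c * ‖k‖ ^ (-μ) ≤ |(∑ i, (k i : ℝ) * ω i) - (p : ℝ)|

/-- A function of the angles that descends to the torus. -/
def IsTorusPeriodic {l : ℕ} {X : Type*} (g : Angle l → X) : Prop :=
  ∀ (θ : Angle l) (k : Fin l → ℤ), g (θ + fun i => (k i : ℝ)) = g θ

/-- `g(θ, J; κ)` is a function on (torus) × `M`, depending on the parameter `κ`, that is real
analytic in all its arguments in a neighbourhood of (torus) × `M` × `{0}`. -/
def IsAnalyticFamily {l m : ℕ} {X : Type*} [NormedAddCommGroup X] [NormedSpace ℝ X]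
    (M : Set (Slow m)) (g : Angle l → Slow m → ℝ → X) : Prop :=
  (∀ J κ, IsTorusPeriodic fun θ => g θ J κ) ∧
    AnalyticOnNhd ℝ (fun p : Angle l × Slow m × ℝ => g p.1 p.2.1 p.2.2)
      (univ ×ˢ M ×ˢ ({0} : Set ℝ))

/-- `g(θ, J)` is a real analytic function on (torus) × `M`. -/
def IsAnalyticOnTorus {l m : ℕ} {X : Type*} [NormedAddCommGroup X] [NormedSpace ℝ X]
    (M : Set (Slow m)) (g : Angle l → Slow m → X) : Prop :=
  (∀ J, IsTorusPeriodic fun θ => g θ J) ∧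
    AnalyticOnNhd ℝ (fun p : Angle l × Slow m => g p.1 p.2) (univ ×ˢ M)

/-- The average over the torus of `g(θ, J; κ)` at `κ = 0`. -/
noncomputable def angleAverage {l m : ℕ} {X : Type*} [NormedAddCommGroup X] [NormedSpace ℝ X]
    (g : Angle l → Slow m → ℝ → X) (J : Slow m) : X :=
  ∫ θ in Icc (0 : Angle l) 1, g θ J 0

/-- The slow-fast map `θ' = θ + ω₀ + κ F(θ, J; κ)`, `J' = J + κ G(θ, J; κ)`. -/
def slowFastMap {l m : ℕ} (ω₀ : Angle l) (F : Angle l → Slow m → ℝ → Angle l)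
    (G : Angle l → Slow m → ℝ → Slow m) (κ : ℝ) (x : Angle l × Slow m) : Angle l × Slow m :=
  (x.1 + ω₀ + κ • F x.1 x.2 κ, x.2 + κ • G x.1 x.2 κ)

/-- Functions produced by the successive decoupling steps: the remainders `F^(j), G^(j)` and the
generators `T^(j), S^(j)` of the transformations. Only `j ≥ 1` is used. -/
structure DecouplingData (l m : ℕ) where
  F : ℕ → Angle l → Slow m → ℝ → Angle l
  G : ℕ → Angle l → Slow m → ℝ → Slow m
  T : ℕ → Angle l → Slow m → Angle l
  S : ℕ → Angle l → Slow m → Slow m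

namespace DecouplingData

variable {l m : ℕ}

/-- The map whose dependence on the angles first appears at order `κ^n`:
`θ' = θ + ω₀ + ∑_{j=1}^{n-1} κ^j F̄^(j)(J) + κ^n F^(n)(θ, J; κ)`,
`J' = J + ∑_{j=1}^{n-1} κ^j Ḡ^(j)(J) + κ^n G^(n)(θ, J; κ)`. -/
noncomputable def normalForm (D : DecouplingData l m) (ω₀ : Angle l) (n : ℕ) (κ : ℝ)
    (x : Angle l × Slow m) : Angle l × Slow m :=
  (x.1 + ω₀ + ∑ j ∈ Finset.Ico 1 n, κ ^ j • angleAverage (D.F j) x.2 + κ ^ n • D.F n x.1 x.2 κ,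
    x.2 + ∑ j ∈ Finset.Ico 1 n, κ ^ j • angleAverage (D.G j) x.2 + κ ^ n • D.G n x.1 x.2 κ)

/-- The inverse of the `n`-th transformation `h^(n)`:
`(ψ, I) ↦ (θ, J) = (ψ + κ^n T^(n)(ψ, I), I + κ^n S^(n)(ψ, I))`. -/
def step (D : DecouplingData l m) (n : ℕ) (κ : ℝ) (y : Angle l × Slow m) : Angle l × Slow m :=
  (y.1 + κ ^ n • D.T n y.1 y.2, y.2 + κ ^ n • D.S n y.1 y.2)

/-- The inverse of `h = h^(n) ∘ ⋯ ∘ h^(1)`, that is `step 1 ∘ ⋯ ∘ step n`. -/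
def hInv (D : DecouplingData l m) : ℕ → ℝ → Angle l × Slow m → Angle l × Slow m
  | 0, _ => id
  | n + 1, κ => D.hInv n κ ∘ D.step (n + 1) κ

/-- The composed transformation `h = h^(n) ∘ ⋯ ∘ h^(1)` taking values in (torus) × `V`. It is
meaningful on the image of (torus) × `V` under `hInv`, when `hInv` is injective there. -/
noncomputable def h (D : DecouplingData l m) (n : ℕ) (V : Set (Slow m)) (κ : ℝ) :
    Angle l × Slow m → Angle l × Slow m :=
  Function.invFunOn (D.hInv n κ) (univ ×ˢ V)

/-- The averaged slow map truncated at order `n`: `Ī' = Ī + ∑_{j=1}^n κ^j Ḡ^(j)(Ī)`. -/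
noncomputable def averagedMap (D : DecouplingData l m) (n : ℕ) (κ : ℝ) (I : Slow m) : Slow m :=
  I + ∑ j ∈ Finset.Icc 1 n, κ ^ j • angleAverage (D.G j) I

/-- `D` describes a sequence of `n` decoupling transformations of the slow-fast map with data
`F, G` on (torus) × `M`: starting from `F^(1) = F`, `G^(1) = G`, for `j = 1, …, n` the analytic
near-identity transformation `step j` conjugates the map decoupled below order `j` to
a map of the same form decoupled below order `j + 1`. -/
structure IsDecoupling (D : DecouplingData l m) (ω₀ : Angle l) (M : Set (Slow m))
    (F : Angle l → Slow m → ℝ → Angle l) (G : Angle l → Slow m → ℝ → Slow m) (n : ℕ) :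
    Prop where
  F_one : D.F 1 = F
  G_one : D.G 1 = G
  analytic_F : ∀ j ∈ Finset.Icc 1 (n + 1), IsAnalyticFamily M (D.F j)
  analytic_G : ∀ j ∈ Finset.Icc 1 (n + 1), IsAnalyticFamily M (D.G j)
  analytic_T : ∀ j ∈ Finset.Icc 1 n, IsAnalyticOnTorus M (D.T j)
  analytic_S : ∀ j ∈ Finset.Icc 1 n, IsAnalyticOnTorus M (D.S j)
  conj : ∀ j ∈ Finset.Icc 1 n, ∀ K : Set (Slow m), IsCompact K → K ⊆ M →
    ∃ κ₀ > 0, ∀ κ : ℝ, |κ| < κ₀ → ∀ ψ : Angle l, ∀ I ∈ K,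
      D.normalForm ω₀ j κ (D.step j κ (ψ, I)) = D.step j κ (D.normalForm ω₀ (j + 1) κ (ψ, I))

end DecouplingData

end SlowFast

/-! Two mechanisms carry the theorem: a cohomological equation over the rotation by ω₀, and a
discrete Gronwall estimate for a corrected error.

Cohomological equation. T(θ+ω₀) − T(θ) = g − ḡ is solved formally by dividing Fourier coefficients
by exp(2πi k·ω₀) − 1, and the Diophantine condition bounds these divisors below by a negative power
of |k|. Rather than using decay of coefficients in a complex strip,
`IsDiophantine.exists_cohomological_solution` applies a power of the Laplacian to g and convolves
with a continuous kernel, whose coefficients are the inverse divisors damped by the same power of ∑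
kᵢ². Real analyticity in (θ, J) then passes through the integral (`analyticAt_setIntegral`).

Existence. By induction on n. If the new generator solves the cohomological equation for the current
remainder at κ = 0, the angle dependence at that order cancels. The next remainder also occurs
inside the argument of the generator, so it is defined by an implicit equation;
`exists_conjugacy_remainder` solves it with difference quotients in κ (`analyticAt_dslope`) and the
implicit function theorem.

Error bound. Compare an orbit x_t of the map decoupled below order n+1 with the averaged orbit. Each
step leaves an oscillating term κ^(n+1)(G^(n+1) − Ḡ^(n+1)), which naively adds up to O(κ^n) over T/κ
steps. To leading order this term is κ^(n+1) times a coboundary S(x+Ω) − S(x), with Ω = (ω₀, 0).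
After subtracting κ^(n+1) S(x_t), the error is multiplied by at most 1 + O(κ) and receives only
O(κ^(n+2)) per step, hence stays O(κ^(n+1)); so does the subtracted correction. S enters as a
bounded function and never as a change of variables, which is why n transformations suffice
(`exists_step_estimate`, `exists_shadowing`).

The bound keeps the decoupled orbit near K, hence in V, and the composed transformation carries it
to the orbit of f. Compactness modulo the lattice makes all thresholds in κ uniform, and a Lipschitz
estimate against the identity makes the transformation a diffeomorphism. -/

open Filter Topology
open scoped NNReal ENNReal

namespace SlowFast

/-! ### Analytic dependence of integrals on parameters, and Hadamard's lemma. -/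

section ParametricIntegral

variable {P E F : Type*} [NormedAddCommGroup P] [NormedSpace ℝ P] [MeasurableSpace P]
  [BorelSpace P] [SecondCountableTopology P] [NormedAddCommGroup E] [NormedSpace ℝ E]
  [NormedAddCommGroup F] [NormedSpace ℝ F] [CompleteSpace F]

omit [MeasurableSpace P] [BorelSpace P] [SecondCountableTopology P] in
/-- Near a parameter value, the power series of the sections `f (t, ·)` have continuous
coefficients and a uniform summable bound. -/
theorem exists_uniform_powerSeries {f : P × E → F} {t₀ : P} {x₀ : E}
    (hf : AnalyticAt ℝ f (t₀, x₀)) :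
    ∃ ρ : ℝ≥0, 0 < ρ ∧ ∃ q : P → FormalMultilinearSeries ℝ E F, ∃ B : ℕ → ℝ≥0,
      (∀ n, ContinuousOn (fun t => q t n) (Metric.ball t₀ ρ)) ∧
      (∀ n, ∀ t ∈ Metric.ball t₀ (ρ : ℝ), ‖q t n‖₊ ≤ B n) ∧
      (Summable fun n => B n * ρ ^ n) ∧
      ∀ t ∈ Metric.ball t₀ (ρ : ℝ), ∀ y : E, ‖y‖₊ < ρ →
        HasSum (fun n => q t n fun _ => y) (f (t, x₀ + y)) := by
  obtain ⟨p, r, hp⟩ := hf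
  obtain ⟨r', hr'0, hr'⟩ := ENNReal.lt_iff_exists_nnreal_btwn.1 hp.r_pos
  have hr'0 : 0 < r' := by exact_mod_cast hr'0
  -- Half the radius: the shift t − t₀ of the centre and the increment y may each have size ρ.
  set ρ : ℝ≥0 := r' / 2 with hρ
  have hρ0 : 0 < ρ := by positivity
  have hρρ : ((ρ : ℝ≥0∞) + ρ) < r := by
    have : ρ + ρ = r' := add_halves r'
    rw [← ENNReal.coe_add, this]; exact hr'
  have hρp : ((ρ : ℝ≥0∞) + ρ) < p.radius := hρρ.trans_le hp.r_le
  have hρr : (ρ : ℝ≥0∞) < p.radius := lt_of_le_of_lt le_self_add hρp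
  have key : ∀ t ∈ Metric.ball t₀ (ρ : ℝ), ‖((t - t₀, 0) : P × E)‖₊ ≤ ρ := by
    intro t ht
    rw [← NNReal.coe_le_coe, coe_nnnorm]
    simpa [Prod.norm_def, ← dist_eq_norm] using (Metric.mem_ball.1 ht).le
  have key' : ∀ t ∈ Metric.ball t₀ (ρ : ℝ), (‖((t - t₀, 0) : P × E)‖₊ : ℝ≥0∞) ≤ ρ :=
    fun t ht => by exact_mod_cast key t ht
  -- The series is re-expanded at (t, x₀) and restricted to increments (0, y). The bound is the
  -- standard majorant of the re-expansion, taken at shift ρ and therefore independent of t.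
  refine ⟨ρ, hρ0, fun t n => (p.changeOrigin (t - t₀, 0) n).compContinuousLinearMap
      fun _ => ContinuousLinearMap.inr ℝ P E,
    fun k => ∑' s : Σ l : ℕ, { s : Finset (Fin (k + l)) // s.card = l }, ‖p (k + s.1)‖₊ * ρ ^ s.1,
    ?_, ?_, ?_, ?_⟩
  · intro n
    have h1 : ContinuousOn (fun x => p.changeOrigin x n) (Metric.eball 0 p.radius) :=
      (p.hasFPowerSeriesOnBall_changeOrigin n (hp.r_pos.trans_le hp.r_le)).continuousOn
    have h2 : ContinuousOn (fun t => p.changeOrigin (t - t₀, 0) n) (Metric.ball t₀ ρ) := by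
      refine h1.comp (f := fun t => ((t - t₀, 0) : P × E)) (by fun_prop) fun t ht => ?_
      exact mem_eball_zero_iff.2 ((key' t ht).trans_lt hρr)
    exact (ContinuousMultilinearMap.compContinuousLinearMapL
      (F := F) fun _ : Fin n => ContinuousLinearMap.inr ℝ P E).continuous.comp_continuousOn h2
  · intro n t ht
    have h1 := p.nnnorm_changeOrigin_le n ((key' t ht).trans_lt hρr)
    have h2 : ‖(p.changeOrigin (t - t₀, 0) n).compContinuousLinearMap
        fun _ => ContinuousLinearMap.inr ℝ P E‖ ≤ ‖p.changeOrigin (t - t₀, 0) n‖ := by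
      refine (ContinuousMultilinearMap.norm_compContinuousLinearMap_le _ _).trans ?_
      refine mul_le_of_le_one_right (norm_nonneg _) ?_
      exact Finset.prod_le_one (fun _ _ => norm_nonneg _)
        fun _ _ => ContinuousLinearMap.norm_inr_le_one ℝ P E
    refine (show _ ≤ ‖p.changeOrigin (t - t₀, 0) n‖₊ from h2).trans (h1.trans ?_)
    refine Summable.tsum_le_tsum (fun s => ?_) ?_ (p.changeOriginSeries_summable_aux₂ hρr n)
    · gcongr; exact key t ht
    · exact p.changeOriginSeries_summable_aux₂ ((key' t ht).trans_lt hρr) n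
  · have := (NNReal.summable_sigma.1 (p.changeOriginSeries_summable_aux₁ hρp)).2
    simpa only [NNReal.tsum_mul_right] using this
  · intro t ht y hy
    have h1 := hp.changeOrigin (y := ((t - t₀, 0) : P × E))
      (((key' t ht).trans_lt (lt_of_le_of_lt le_self_add hρρ)))
    have h2 := h1.hasSum (y := ((0, y) : P × E)) (by
      rw [mem_eball_zero_iff, lt_tsub_iff_right]
      refine lt_of_le_of_lt (add_le_add ?_ (key' t ht)) hρρ
      have : ‖((0, y) : P × E)‖₊ = ‖y‖₊ := by
        simp [Prod.nnnorm_def]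
      rw [enorm_eq_nnnorm, this]
      exact_mod_cast hy.le)
    simpa using h2

/-- The uniform expansion is integrated term by term, by dominated convergence. Allowing every
measurable piece `A` of `U ∩ C` lets a finite cover be cut into disjoint pieces, and integrability
is recorded because additivity over these pieces requires it. -/
theorem exists_nhds_analyticAt_setIntegral {ν : Measure P} {C : Set P} (hC : IsCompact C)
    [IsFiniteMeasureOnCompacts ν] {w : P → ℝ} (hw : Continuous w) {f : P × E → F} {t₀ : P} {x₀ : E}
    (hf : AnalyticAt ℝ f (t₀, x₀)) :
    ∃ U ∈ 𝓝 t₀, MeasurableSet U ∧ ∀ A, MeasurableSet A → A ⊆ U ∩ C →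
      (∀ᶠ x in 𝓝 x₀, IntegrableOn (fun t => w t • f (t, x)) A ν) ∧
      AnalyticAt ℝ (fun x => ∫ t in A, w t • f (t, x) ∂ν) x₀ := by
  obtain ⟨ρ, hρ, q, B, hqc, hqB, hB, hsum⟩ := exists_uniform_powerSeries hf
  refine ⟨Metric.ball t₀ ρ, Metric.ball_mem_nhds _ (by exact_mod_cast hρ),
    Metric.isOpen_ball.measurableSet, fun A hA hAU => ?_⟩
  have hAU' : A ⊆ Metric.ball t₀ ρ := fun t ht => (hAU ht).1
  have hAfin : ν A < ⊤ := (measure_mono fun t ht => (hAU ht).2).trans_lt hC.measure_lt_top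
  have : IsFiniteMeasure (ν.restrict A) := ⟨by simpa using hAfin⟩
  obtain ⟨W, hW⟩ := hC.exists_bound_of_continuousOn hw.continuousOn
  have hW' : ∀ t ∈ A, ‖w t‖ ≤ W := fun t ht => hW t (hAU ht).2
  have hint : ∀ n, IntegrableOn (fun t => w t • q t n) A ν := by
    intro n
    refine Integrable.of_bound ?_ (W * B n) ?_
    · exact (hw.continuousOn.smul ((hqc n).mono hAU')).aestronglyMeasurable hA
    · refine (ae_restrict_iff' hA).2 (Eventually.of_forall fun t ht => ?_)
      rw [norm_smul]
      exact mul_le_mul (hW' t ht) (hqB n t (hAU' ht)) (norm_nonneg _)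
        ((norm_nonneg _).trans (hW' t ht))
  have hbound : ∀ n, ∀ t ∈ A, ∀ y : E, ‖y‖₊ < ρ →
      ‖w t • q t n fun _ => y‖ ≤ W * (B n * ρ ^ n) := by
    intro n t ht y hy
    rw [norm_smul]
    have h1 : ‖q t n fun _ => y‖ ≤ ‖q t n‖ * ‖y‖ ^ n := by
      simpa using (q t n).le_opNorm fun _ => y
    refine mul_le_mul (hW' t ht) (h1.trans ?_) (norm_nonneg _) ((norm_nonneg _).trans (hW' t ht))
    have h2 : ‖q t n‖ ≤ B n := hqB n t (hAU' ht)
    have h3 : ‖y‖ ≤ ρ := hy.le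
    gcongr
  have hBs : Summable fun n => (B n * ρ ^ n : ℝ) := by exact_mod_cast hB
  have happ : ∀ n, ∀ y : E, IntegrableOn (fun t => w t • q t n fun _ => y) A ν := by
    intro n y
    exact (ContinuousMultilinearMap.apply ℝ (fun _ : Fin n => E) F fun _ => y).integrable_comp
      (hint n)
  have hHas : ∀ y : E, ‖y‖₊ < ρ → HasSum (fun n => ∫ t in A, w t • q t n (fun _ => y) ∂ν)
      (∫ t in A, w t • f (t, x₀ + y) ∂ν) := by
    intro y hy
    refine hasSum_integral_of_dominated_convergence (fun n _ => W * (B n * ρ ^ n))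
      (fun n => (happ n y).aestronglyMeasurable) (fun n => ?_) ?_ ?_ ?_
    · exact (ae_restrict_iff' hA).2 (Eventually.of_forall fun t ht => hbound n t ht y hy)
    · exact Eventually.of_forall fun _ => hBs.mul_left W
    · exact integrableOn_const hAfin.ne
    · exact (ae_restrict_iff' hA).2 (Eventually.of_forall fun t ht =>
        (hsum t (hAU' ht) y hy).const_smul (w t))
  refine ⟨?_, fun n => ∫ t in A, w t • q t n ∂ν, ρ, ?_, by exact_mod_cast hρ, ?_⟩
  · filter_upwards [Metric.ball_mem_nhds x₀ (show (0 : ℝ) < ρ by exact_mod_cast hρ)] with x hx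
    have hy : ‖x - x₀‖₊ < ρ := by
      rw [← NNReal.coe_lt_coe, coe_nnnorm, ← dist_eq_norm]; exact hx
    have hlim : ∀ t ∈ A, HasSum (fun n => w t • q t n fun _ => x - x₀) (w t • f (t, x)) := by
      intro t ht
      simpa using (hsum t (hAU' ht) (x - x₀) hy).const_smul (w t)
    refine Integrable.of_bound ?_ (∑' n, W * (B n * ρ ^ n)) ?_
    · refine aestronglyMeasurable_of_tendsto_ae atTop
        (f := fun N t => ∑ n ∈ Finset.range N, w t • q t n fun _ => x - x₀) (fun N => ?_) ?_
      · exact (integrable_finsetSum _ fun n _ => happ n (x - x₀)).aestronglyMeasurable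
      · exact (ae_restrict_iff' hA).2 (Eventually.of_forall fun t ht =>
          (hlim t ht).tendsto_sum_nat)
    · refine (ae_restrict_iff' hA).2 (Eventually.of_forall fun t ht => ?_)
      rw [← (hlim t ht).tsum_eq]
      exact tsum_of_norm_bounded (hBs.mul_left W).hasSum fun n => hbound n t ht _ hy
  · refine FormalMultilinearSeries.le_radius_of_bound _ ((ν.real A * W) * ∑' n, (B n * ρ ^ n : ℝ))
      fun n => ?_
    have h1 : ‖∫ t in A, w t • q t n ∂ν‖ ≤ (W * B n) * ν.real A := by
      refine norm_setIntegral_le_of_norm_le_const hAfin fun t ht => ?_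
      rw [norm_smul]
      exact mul_le_mul (hW' t ht) (hqB n t (hAU' ht)) (norm_nonneg _)
        ((norm_nonneg _).trans (hW' t ht))
    rcases A.eq_empty_or_nonempty with rfl | ⟨t, ht⟩
    · simp
    have hW0 : 0 ≤ W := (norm_nonneg _).trans (hW' t ht)
    calc ‖∫ t in A, w t • q t n ∂ν‖ * (ρ : ℝ) ^ n ≤ (W * B n) * ν.real A * (ρ : ℝ) ^ n := by gcongr
      _ = ν.real A * W * (B n * (ρ : ℝ) ^ n) := by ring
      _ ≤ _ := by
        gcongr
        exact hBs.le_tsum n fun _ _ => by positivity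
  · intro y hy
    have hy' : ‖y‖₊ < ρ := by
      rw [mem_eball_zero_iff, enorm_eq_nnnorm] at hy; exact_mod_cast hy
    convert hHas y hy' using 2 with n
    exact ((ContinuousMultilinearMap.apply ℝ (fun _ : Fin n => E) F
      fun _ => y).integral_comp_comm (hint n)).symm

/-- Integrals of analytic functions over a compact parameter set are analytic. -/
theorem analyticAt_setIntegral {ν : Measure P} {C : Set P} (hC : IsCompact C)
    [IsFiniteMeasureOnCompacts ν] {w : P → ℝ} (hw : Continuous w) {f : P × E → F} {x₀ : E}
    (hf : ∀ t ∈ C, AnalyticAt ℝ f (t, x₀)) :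
    AnalyticAt ℝ (fun x => ∫ t in C, w t • f (t, x) ∂ν) x₀ := by
  obtain ⟨U, hCU, hU, h⟩ : ∃ U, C ⊆ U ∧ MeasurableSet U ∧ ∀ A, MeasurableSet A → A ⊆ U ∩ C →
      (∀ᶠ x in 𝓝 x₀, IntegrableOn (fun t => w t • f (t, x)) A ν) ∧
      AnalyticAt ℝ (fun x => ∫ t in A, w t • f (t, x) ∂ν) x₀ := by
    refine hC.induction_on (p := fun s => ∃ U, s ⊆ U ∧ MeasurableSet U ∧
      ∀ A, MeasurableSet A → A ⊆ U ∩ C →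
      (∀ᶠ x in 𝓝 x₀, IntegrableOn (fun t => w t • f (t, x)) A ν) ∧
      AnalyticAt ℝ (fun x => ∫ t in A, w t • f (t, x) ∂ν) x₀) ?_ ?_ ?_ ?_
    · refine ⟨∅, Subset.rfl, MeasurableSet.empty, fun A _ hA => ?_⟩
      obtain rfl : A = ∅ := subset_empty_iff.1 fun t ht => (hA ht).1
      simp [analyticAt_const]
    · rintro s t hst ⟨U, hU, h⟩
      exact ⟨U, hst.trans hU, h⟩
    · rintro s t ⟨U, hsU, hU, h⟩ ⟨V, htV, hV, h'⟩
      refine ⟨U ∪ V, union_subset_union hsU htV, hU.union hV, fun A hA hAUV => ?_⟩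
      obtain ⟨h1, h2⟩ := h (A ∩ U) (hA.inter hU) fun t ht => ⟨ht.2, (hAUV ht.1).2⟩
      obtain ⟨h3, h4⟩ := h' (A \ U) (hA.diff hU)
        fun t ht => ⟨(hAUV ht.1).1.resolve_left ht.2, (hAUV ht.1).2⟩
      refine ⟨?_, (h2.add h4).congr ?_⟩
      · filter_upwards [h1, h3] with x hx hx'
        simpa only [inter_union_sdiff] using hx.union hx'
      · filter_upwards [h1, h3] with x hx hx'
        rw [Pi.add_apply, ← setIntegral_union (disjoint_sdiff_right.mono_left inter_subset_right) (hA.diff hU) hx hx',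
          inter_union_sdiff]
    · intro t ht
      obtain ⟨U, hU, hUm, h⟩ := exists_nhds_analyticAt_setIntegral (ν := ν) hC hw (hf t ht)
      exact ⟨U, mem_nhdsWithin_of_mem_nhds hU, U, Subset.rfl, hUm, h⟩
  exact (h C hC.measurableSet fun t ht => ⟨hCU ht, ht⟩).2

end ParametricIntegral

/-- **Hadamard's lemma**, analytic case: the difference quotient in the last variable is jointly
analytic. -/
theorem analyticAt_dslope {E F : Type*} [NormedAddCommGroup E] [NormedSpace ℝ E]
    [NormedAddCommGroup F] [NormedSpace ℝ F] [CompleteSpace F] {f : E × ℝ → F} {x₀ : E}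
    (hf : AnalyticAt ℝ f (x₀, 0)) :
    AnalyticAt ℝ (fun p : E × ℝ => dslope (fun s => f (p.1, s)) 0 p.2) (x₀, 0) := by
  -- The difference quotient is the average over t ∈ [0, 1] of the derivative in the last variable
  -- at t·s, by the fundamental theorem of calculus.
  have h1 : AnalyticAt ℝ (fun p : E × ℝ => ∫ t in Icc (0 : ℝ) 1,
      (1 : ℝ) • fderiv ℝ f (p.1, t * p.2) (0, 1)) (x₀, 0) := by
    refine analyticAt_setIntegral (f := fun q : ℝ × (E × ℝ) =>
      fderiv ℝ f (q.2.1, q.1 * q.2.2) (0, 1)) isCompact_Icc continuous_const fun t _ => ?_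
    have h2 : AnalyticAt ℝ (fderiv ℝ f) (x₀, t * 0) := by simpa using hf.fderiv
    have h3 : AnalyticAt ℝ (fun q : ℝ × (E × ℝ) => fderiv ℝ f (q.2.1, q.1 * q.2.2))
        (t, (x₀, 0)) :=
      h2.fun_comp (f := fun q : ℝ × (E × ℝ) => (q.2.1, q.1 * q.2.2))
        ((analyticAt_fst.comp analyticAt_snd).prod
          (analyticAt_fst.mul (analyticAt_snd.comp analyticAt_snd)))
    exact ((ContinuousLinearMap.apply ℝ F ((0, 1) : E × ℝ)).analyticAt _).comp h3
  refine h1.congr ?_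
  obtain ⟨r, hr, hball⟩ := hf.exists_ball_analyticOnNhd
  filter_upwards [Metric.ball_mem_nhds _ hr] with p hp
  have hmem : ∀ t ∈ Icc (0 : ℝ) 1, (p.1, t * p.2) ∈ Metric.ball (x₀, (0 : ℝ)) r := by
    intro t ht
    rw [Metric.mem_ball, Prod.dist_eq, max_lt_iff] at hp ⊢
    refine ⟨hp.1, lt_of_le_of_lt ?_ hp.2⟩
    simp only [dist_zero_right, norm_mul, Real.norm_eq_abs]
    rw [abs_of_nonneg ht.1]
    exact mul_le_of_le_one_left (abs_nonneg _) ht.2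
  simp only [one_smul]
  have hline : ∀ t ∈ Icc (0 : ℝ) 1, HasDerivAt (fun s => f (p.1, s))
      (fderiv ℝ f (p.1, t * p.2) (0, 1)) (t * p.2) := by
    intro t ht
    have := (hball _ (hmem t ht)).differentiableAt.hasFDerivAt
    exact this.comp_hasDerivAt (t * p.2) ((hasDerivAt_const _ _).prodMk (hasDerivAt_id _))
  rcases eq_or_ne p.2 0 with h0 | h0
  · rw [h0, dslope_same, (by simpa [h0] using (hline 0 (by simp)) :
      HasDerivAt (fun s => f (p.1, s)) (fderiv ℝ f (p.1, 0) (0, 1)) 0).deriv]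
    simp
  · rw [dslope_of_ne _ h0, slope_def_module, sub_zero]
    have hd : ∀ t ∈ uIcc (0 : ℝ) 1, HasDerivAt (fun t => f (p.1, t * p.2))
        (p.2 • fderiv ℝ f (p.1, t * p.2) (0, 1)) t := by
      intro t ht
      rw [uIcc_of_le zero_le_one] at ht
      exact (hline t ht).scomp t (by simpa using (hasDerivAt_id t).mul_const p.2)
    have hc : ContinuousOn (fun t : ℝ => p.2 • fderiv ℝ f (p.1, t * p.2) (0, 1)) (uIcc 0 1) := by
      rw [uIcc_of_le zero_le_one]
      have : ContinuousOn (fun t : ℝ => fderiv ℝ f (p.1, t * p.2)) (Icc 0 1) :=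
        hball.fderiv.continuousOn.comp (by fun_prop) hmem
      exact (this.clm_apply continuousOn_const).const_smul p.2
    have h4 := intervalIntegral.integral_eq_sub_of_hasDerivAt hd hc.intervalIntegrable
    rw [intervalIntegral.integral_smul, intervalIntegral.integral_of_le zero_le_one,
      ← integral_Icc_eq_integral_Ioc] at h4
    simp only [one_mul, zero_mul] at h4
    rw [← h4, smul_smul, inv_mul_cancel₀ h0, one_smul]

end SlowFast

namespace SlowFast

/-! ### Fourier analysis of periodic functions on ℝ^l. -/

section Fourier

variable {l : ℕ}

/-- The character `t ↦ exp (2πi k ⬝ t)`. -/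
noncomputable def character (k : Fin l → ℤ) (t : Angle l) : ℂ :=
  Complex.exp (2 * Real.pi * Complex.I * ∑ i, (k i : ℂ) * (t i : ℂ))

/-- The Fourier coefficients of a function on the torus. -/
noncomputable def fourierCoefficient (f : Angle l → ℂ) (k : Fin l → ℤ) : ℂ :=
  ∫ t in Icc (0 : Angle l) 1, character (-k) t * f t

theorem character_eq_mFourier (k : Fin l → ℤ) (t : Angle l) :
    character k t = UnitAddTorus.mFourier k fun i => (t i : UnitAddCircle) := by
  simp only [character, UnitAddTorus.mFourier, ContinuousMap.coe_mk, fourier_coe_apply,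
    ← Complex.exp_sum, Finset.mul_sum]
  congr 1
  refine Finset.sum_congr rfl fun i _ => ?_
  push_cast
  ring

theorem continuous_character (k : Fin l → ℤ) : Continuous (character k) := by
  unfold character; fun_prop

theorem norm_character (k : Fin l → ℤ) (t : Angle l) : ‖character k t‖ = 1 := by
  have : (2 * Real.pi * Complex.I * ∑ i, (k i : ℂ) * (t i : ℂ))
      = ((2 * Real.pi * ∑ i, (k i : ℝ) * t i : ℝ) : ℂ) * Complex.I := by push_cast; ring
  rw [character, this, Complex.norm_exp_ofReal_mul_I]

theorem character_add (k : Fin l → ℤ) (s t : Angle l) :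
    character k (s + t) = character k s * character k t := by
  simp only [character, ← Complex.exp_add, ← mul_add, ← Finset.sum_add_distrib]
  congr 3; ext i; push_cast [Pi.add_apply]; ring

theorem character_neg_mul_self (k : Fin l → ℤ) (t : Angle l) :
    character (-k) t * character k t = 1 := by
  simp [character, ← Complex.exp_add]

theorem character_zero (t : Angle l) : character 0 t = 1 := by simp [character]

theorem isTorusPeriodic_character (k : Fin l → ℤ) : IsTorusPeriodic (character k) := by
  intro θ j
  rw [character_eq_mFourier, character_eq_mFourier]
  congr 1; ext i
  simp

theorem measurableSet_cube : MeasurableSet (Icc (0 : Angle l) 1) := measurableSet_Icc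

/-- The projection of ℝ^l to the torus is an open quotient map, so periodic continuous functions
descend. This gives access to Haar measure and Fourier series on `UnitAddTorus`. -/
theorem exists_continuousMap_torus {f : Angle l → ℂ} (hf : Continuous f) (hp : IsTorusPeriodic f) :
    ∃ g : C(UnitAddTorus (Fin l), ℂ), ∀ t : Angle l, g (fun i => (t i : UnitAddCircle)) = f t := by
  have hq : IsOpenQuotientMap fun (t : Angle l) (i : Fin l) => ((t i : ℝ) : UnitAddCircle) := by
    exact IsOpenQuotientMap.piMap fun _ => QuotientAddGroup.isOpenQuotientMap_mk
  have hfac : ∀ s t : Angle l, (fun i => ((s i : ℝ) : UnitAddCircle)) = (fun i => (t i : UnitAddCircle)) →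
      f s = f t := by
    intro s t hst
    have : ∀ i, ∃ k : ℤ, s i = t i + k := by
      intro i
      have h := congrFun hst i
      obtain ⟨k, hk⟩ := (QuotientAddGroup.eq_iff_sub_mem.1 h)
      exact ⟨k, by simp at hk; linarith⟩
    choose k hk using this
    rw [show s = t + fun i => (k i : ℝ) from funext hk, hp]
  refine ⟨⟨fun x => f (Function.surjInv hq.surjective x), ?_⟩, fun t => ?_⟩
  · refine hq.isQuotientMap.continuous_iff.2 ?_
    refine hf.congr fun t => hfac _ _ ?_
    exact (Function.surjInv_eq hq.surjective _).symm
  · exact hfac _ _ (Function.surjInv_eq hq.surjective _)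

/-- The circle `ℝ / ℤ` with its Haar probability measure. -/
noncomputable local instance instMeasureSpaceCircle : MeasureSpace UnitAddCircle :=
  ⟨AddCircle.haarAddCircle⟩

local instance instIsAddHaarMeasureCircle : Measure.IsAddHaarMeasure (volume : Measure UnitAddCircle) :=
  inferInstanceAs (Measure.IsAddHaarMeasure AddCircle.haarAddCircle)

local instance instIsProbabilityMeasureCircle : IsProbabilityMeasure (volume : Measure UnitAddCircle) :=
  inferInstanceAs (IsProbabilityMeasure AddCircle.haarAddCircle)

theorem setIntegral_cube_eq_integral_torus (g : UnitAddTorus (Fin l) → ℂ) :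
    ∫ t in Icc (0 : Angle l) 1, g (fun i => (t i : UnitAddCircle)) = ∫ x, g x := by
  rw [UnitAddTorus.integral_preimage g 0]
  refine setIntegral_congr_set ?_
  have : {x : Fin l → ℝ | ∀ i, x i ∈ Ioc ((0 : Angle l) i) ((0 : Angle l) i + 1)}
      = univ.pi fun i => Ioc ((0 : Angle l) i) ((1 : Angle l) i) := by
    ext; simp
  rw [this]
  exact Measure.univ_pi_Ioc_ae_eq_Icc.symm

/-- On the torus this is translation invariance of Haar measure. -/
theorem setIntegral_cube_add {f : Angle l → ℂ} (hf : Continuous f) (hp : IsTorusPeriodic f)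
    (v : Angle l) :
    ∫ t in Icc (0 : Angle l) 1, f (t + v) = ∫ t in Icc (0 : Angle l) 1, f t := by
  obtain ⟨g, hg⟩ := exists_continuousMap_torus hf hp
  have h1 := setIntegral_cube_eq_integral_torus (fun x => g (x + fun i => (v i : UnitAddCircle)))
  have h2 := setIntegral_cube_eq_integral_torus g
  rw [integral_add_right_eq_self (fun x => g x)] at h1
  simp only [hg] at h2
  rw [h2, ← h1]
  refine setIntegral_congr_fun measurableSet_cube fun t _ => ?_
  simp only [← hg]
  rfl

theorem hasSum_fourier {f : Angle l → ℂ} (hf : Continuous f) (hp : IsTorusPeriodic f)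
    (hs : Summable (fourierCoefficient f)) (t : Angle l) :
    HasSum (fun k => fourierCoefficient f k * character k t) (f t) := by
  obtain ⟨g, hg⟩ := exists_continuousMap_torus hf hp
  have h1 : ∀ k, UnitAddTorus.mFourierCoeff g k = fourierCoefficient f k := by
    intro k
    rw [UnitAddTorus.mFourierCoeff, ← setIntegral_cube_eq_integral_torus]
    simp only [hg, smul_eq_mul, ← character_eq_mFourier, fourierCoefficient]
  have h2 := UnitAddTorus.hasSum_mFourier_series_apply_of_summable (f := g)
    (by simpa only [funext h1] using hs) (fun i => (t i : UnitAddCircle))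
  simpa only [h1, hg, smul_eq_mul, ← character_eq_mFourier] using h2

/-- The integral of a translate does not depend on the translation, so its derivative, taken under
the integral sign, vanishes. Applied to products, this is integration by parts without boundary
terms. -/
theorem setIntegral_cube_lineDeriv {g g' : Angle l → ℂ} (hg : Continuous g) (hg' : Continuous g')
    (hp : IsTorusPeriodic g) (v : Angle l)
    (hd : ∀ θ, HasDerivAt (fun s : ℝ => g (θ + s • v)) (g' θ) 0) :
    ∫ t in Icc (0 : Angle l) 1, g' t = 0 := by
  have hd' : ∀ θ (s : ℝ), HasDerivAt (fun s : ℝ => g (θ + s • v)) (g' (θ + s • v)) s := by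
    intro θ s
    have h1 : HasDerivAt (fun r : ℝ => g (θ + s • v + r • v)) (g' (θ + s • v)) (s - s) := by
      simpa using hd (θ + s • v)
    refine (h1.comp_sub_const s s).congr_of_eventuallyEq (Eventually.of_forall fun r => ?_)
    simp only [add_assoc, ← add_smul, add_sub_cancel]
  obtain ⟨C, hC⟩ := ((isCompact_Icc (a := (0 : Angle l)) (b := 1)).prod
    (isCompact_Icc (a := (-1 : ℝ)) (b := 1))).exists_bound_of_continuousOn
    (f := fun p : Angle l × ℝ => g' (p.1 + p.2 • v)) (by fun_prop)
  have h := (hasDerivAt_integral_of_dominated_loc_of_deriv_le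
    (μ := volume.restrict (Icc (0 : Angle l) 1)) (x₀ := (0 : ℝ)) (s := Ioo (-1 : ℝ) 1)
    (F := fun s t => g (t + s • v)) (F' := fun s t => g' (t + s • v)) (bound := fun _ => C)
    (Ioo_mem_nhds (by norm_num) (by norm_num)) ?_ ?_ ?_ ?_ ?_ ?_).2
  · simp only [setIntegral_cube_add hg hp, zero_smul, add_zero] at h
    exact h.unique (hasDerivAt_const _ _)
  · exact Eventually.of_forall fun s => Continuous.aestronglyMeasurable (by fun_prop)
  · exact (Continuous.continuousOn (by fun_prop)).integrableOn_compact isCompact_Icc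
  · exact Continuous.aestronglyMeasurable (by fun_prop)
  · refine (ae_restrict_iff' measurableSet_cube).2 (Eventually.of_forall fun t ht s hs => ?_)
    exact hC (t, s) ⟨ht, hs.1.le, hs.2.le⟩
  · exact integrableOn_const isCompact_Icc.measure_lt_top.ne
  · exact Eventually.of_forall fun t s _ => hd' t s

theorem IsTorusPeriodic.mul {f g : Angle l → ℂ} (hf : IsTorusPeriodic f) (hg : IsTorusPeriodic g) :
    IsTorusPeriodic fun t => f t * g t := fun θ k => by simp only [hf θ k, hg θ k]

theorem hasDerivAt_character (k : Fin l → ℤ) (i : Fin l) (θ : Angle l) :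
    HasDerivAt (fun s : ℝ => character k (θ + s • Pi.single i 1))
      (2 * Real.pi * Complex.I * k i * character k θ) 0 := by
  have h : ∀ s : ℝ, character k (θ + s • Pi.single i 1)
      = character k θ * Complex.exp ((2 * Real.pi * Complex.I * k i) * s) := by
    intro s
    rw [character_add]
    congr 1
    simp only [character, Pi.smul_apply, Pi.single_apply, smul_eq_mul]
    congr 1
    rw [Finset.sum_eq_single i] <;> simp +contextual
    ring
  simp only [h]
  have h1 : HasDerivAt (fun s : ℝ => (s : ℂ)) 1 0 := Complex.ofRealCLM.hasDerivAt
  have h2 := ((h1.const_mul (2 * Real.pi * Complex.I * k i)).cexp).const_mul (character k θ)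
  refine h2.congr_deriv ?_
  simp; ring

theorem fourierCoefficient_lineDeriv {f f' : Angle l → ℂ} (hf : Continuous f)
    (hf' : Continuous f') (hp : IsTorusPeriodic f) (i : Fin l)
    (hd : ∀ θ, HasDerivAt (fun s : ℝ => f (θ + s • Pi.single i 1)) (f' θ) 0) (k : Fin l → ℤ) :
    fourierCoefficient f' k = 2 * Real.pi * Complex.I * k i * fourierCoefficient f k := by
  have hc := continuous_character (-k)
  have h := setIntegral_cube_lineDeriv (g := fun t => character (-k) t * f t)
    (g' := fun t => (2 * Real.pi * Complex.I * ((-k) i : ℤ) * character (-k) t) * f t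
      + character (-k) t * f' t) (by fun_prop) (by fun_prop)
    ((isTorusPeriodic_character _).mul hp) (Pi.single i 1)
    (fun θ => by
      have h1 := (hasDerivAt_character (-k) i θ).mul (hd θ)
      simp only [zero_smul, add_zero] at h1
      exact h1)
  rw [integral_add] at h
  · have h2 : ∀ t, (2 * Real.pi * Complex.I * ((-k) i : ℤ) * character (-k) t) * f t
        = -(2 * Real.pi * Complex.I * k i) * (character (-k) t * f t) := by
      intro t; push_cast [Pi.neg_apply]; ring
    simp only [h2] at h
    rw [integral_const_mul] at h
    rw [fourierCoefficient, fourierCoefficient]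
    linear_combination h
  · exact (Continuous.continuousOn (by fun_prop)).integrableOn_compact isCompact_Icc
  · exact (Continuous.continuousOn (by fun_prop)).integrableOn_compact isCompact_Icc

theorem fourierCoefficient_add {f : Angle l → ℂ} (hf : Continuous f) (hp : IsTorusPeriodic f)
    (v : Angle l) (k : Fin l → ℤ) :
    ∫ t in Icc (0 : Angle l) 1, character (-k) t * f (v + t)
      = character k v * fourierCoefficient f k := by
  have h := setIntegral_cube_add ((continuous_character (-k)).mul hf)
    ((isTorusPeriodic_character (-k)).mul hp) v
  simp only [Pi.mul_apply] at h
  rw [fourierCoefficient, ← h, ← integral_const_mul]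
  refine setIntegral_congr_fun measurableSet_cube fun t _ => ?_
  simp only [character_add, add_comm v t]
  linear_combination (-character (-k) t * f (t + v)) * character_neg_mul_self k v

theorem norm_fourierCoefficient_le {f : Angle l → ℂ} {C : ℝ} (hC : ∀ t ∈ Icc (0 : Angle l) 1, ‖f t‖ ≤ C) (k : Fin l → ℤ) :
    ‖fourierCoefficient f k‖ ≤ C := by
  have h := norm_setIntegral_le_of_norm_le_const (μ := volume) (s := Icc (0 : Angle l) 1)
    (f := fun t => character (-k) t * f t) (C := C) isCompact_Icc.measure_lt_top
    (fun t ht => by simpa [norm_character] using hC t ht)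
  simpa [fourierCoefficient, Measure.real, Real.volume_Icc_pi] using h

/-- Convolution with a kernel given by an absolutely convergent Fourier series. -/
theorem hasSum_kernel {b : (Fin l → ℤ) → ℂ} (hb : Summable fun k => ‖b k‖) {h : Angle l → ℂ}
    (hc : Continuous h) (hp : IsTorusPeriodic h) (θ : Angle l) :
    HasSum (fun k => b k * (character k θ * fourierCoefficient h k))
      (∫ t in Icc (0 : Angle l) 1, (∑' k, b k * character (-k) t) * h (θ + t)) := by
  obtain ⟨C, hC⟩ := (isCompact_Icc (a := (0 : Angle l)) (b := 1)).exists_bound_of_continuousOn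
    (f := fun t => h (θ + t)) (by fun_prop)
  have hsum : ∀ t, Summable fun k => b k * character (-k) t := fun t =>
    Summable.of_norm (by simpa [norm_character] using hb)
  have := hasSum_integral_of_dominated_convergence (μ := volume.restrict (Icc (0 : Angle l) 1))
    (F := fun k t => b k * (character (-k) t * h (θ + t)))
    (f := fun t => (∑' k, b k * character (-k) t) * h (θ + t)) (fun k _ => ‖b k‖ * C) ?_ ?_ ?_ ?_ ?_
  · simpa only [integral_const_mul, fourierCoefficient_add hc hp] using this
  · intro k
    have := continuous_character (-k)
    exact Continuous.aestronglyMeasurable (by fun_prop)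
  · intro k
    refine (ae_restrict_iff' measurableSet_cube).2 (Eventually.of_forall fun t ht => ?_)
    rw [norm_mul, norm_mul, norm_character, one_mul]
    exact mul_le_mul_of_nonneg_left (hC t ht) (norm_nonneg _)
  · exact Eventually.of_forall fun t => hb.mul_right C
  · exact integrableOn_const isCompact_Icc.measure_lt_top.ne
  · refine Eventually.of_forall fun t => ?_
    simpa only [mul_assoc] using (hsum t).hasSum.mul_right (h (θ + t))

/-- The kernel solves the cohomological equation over the rotation by `ω`. -/
theorem cohomological_kernel {ω : Angle l} {b d : (Fin l → ℤ) → ℂ} (hb : Summable fun k => ‖b k‖)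
    (hb0 : b 0 = 0) (hbd : ∀ k ≠ 0, b k * (character k ω - 1) * d k = 1) {f h : Angle l → ℂ}
    (hf : Continuous f) (hfp : IsTorusPeriodic f) (hh : Continuous h) (hhp : IsTorusPeriodic h)
    (hfh : ∀ k, fourierCoefficient h k = d k * fourierCoefficient f k) (θ : Angle l) :
    (∫ t in Icc (0 : Angle l) 1, (∑' k, b k * character (-k) t) * h (θ + ω + t))
      - (∫ t in Icc (0 : Angle l) 1, (∑' k, b k * character (-k) t) * h (θ + t))
      = f θ - ∫ t in Icc (0 : Angle l) 1, f t := by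
  obtain ⟨C, hC⟩ := (isCompact_Icc (a := (0 : Angle l)) (b := 1)).exists_bound_of_continuousOn
    hh.continuousOn
  have h0 : fourierCoefficient f 0 = ∫ t in Icc (0 : Angle l) 1, f t := by
    simp [fourierCoefficient, character_zero]
  have hcoef : ∀ k ≠ 0, fourierCoefficient f k = b k * (character k ω - 1) * fourierCoefficient h k := by
    intro k hk
    rw [hfh]; linear_combination (-fourierCoefficient f k) * hbd k hk
  -- Outside k = 0 the coefficients of `f` are those of the kernel times bounded factors, so
  -- absolute convergence is inherited from `b`.
  have hs : Summable (fourierCoefficient f) := by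
    refine Summable.of_norm_bounded_eventually (g := fun k => ‖b k‖ * (2 * C)) (hb.mul_right _) ?_
    refine (Set.finite_singleton (0 : Fin l → ℤ)).subset fun k hk => ?_
    by_contra hk0
    refine hk ?_
    rw [mem_ofPred_eq, hcoef k hk0, norm_mul, norm_mul, mul_assoc]
    have h1 : ‖character k ω - 1‖ ≤ 2 := by
      refine (norm_sub_le _ _).trans ?_
      rw [norm_character]; norm_num
    have := norm_fourierCoefficient_le hC k
    gcongr
  have h1 := hasSum_fourier hf hfp hs θ
  have h2 := (hasSum_kernel hb hh hhp (θ + ω)).sub (hasSum_kernel hb hh hhp θ)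
  -- The mean of `f` is removed as the term k = 0, where `b` vanishes as well.
  have h3 : HasSum (fun k : Fin l → ℤ => if k = 0 then fourierCoefficient f 0 else 0)
      (fourierCoefficient f 0) := hasSum_ite_eq 0 _
  rw [← h0]
  refine (h2.unique ((h1.sub h3).congr_fun fun k => ?_))
  by_cases hk : k = 0
  · simp [hk, hb0, character_zero]
  · simp only [hk, if_false, character_add]
    rw [hcoef k hk]; ring

end Fourier
end SlowFast

namespace SlowFast

/-! ### Small divisors of a Diophantine rotation. -/

section Diophantine

variable {l : ℕ}

/-- Instance of convergence of lattice sums for exponents below minus the rank; the integer vectors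
are embedded as the span of the standard basis. -/
theorem summable_norm_rpow_int (r : ℝ) (hr : r < -l) :
    Summable fun k : Fin l → ℤ => ‖k‖ ^ r := by
  let φ : (Fin l → ℤ) →ₗ[ℤ] (Fin l → ℝ) :=
    { toFun := fun k i => k i
      map_add' := fun _ _ => by ext; simp
      map_smul' := fun _ _ => by ext; simp }
  have hφ : ∀ k, φ k ∈ Submodule.span ℤ (range (Pi.basisFun ℝ (Fin l))) := by
    intro k
    have : φ k = ∑ i, k i • Pi.basisFun ℝ (Fin l) i := by
      ext j
      simp [φ, Finset.sum_apply, Pi.single_apply]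
    rw [this]
    exact Submodule.sum_mem _ fun i _ => Submodule.smul_mem _ _ (Submodule.subset_span ⟨i, rfl⟩)
  have h := ZLattice.summable_norm_rpow (Submodule.span ℤ (range (Pi.basisFun ℝ (Fin l)))) r (by
    refine hr.trans_le (neg_le_neg ?_)
    have := finrank_range_le_card (R := ℤ) (Pi.basisFun ℝ (Fin l))
    rw [Fintype.card_fin] at this
    exact_mod_cast this)
  refine (h.comp_injective (i := fun k => ⟨φ k, hφ k⟩) fun k k' hk => ?_).congr fun k => ?_
  · ext i
    have : ((k i : ℤ) : ℝ) = k' i := congrFun (congrArg Subtype.val hk) i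
    exact_mod_cast this
  · simp only [Function.comp, Submodule.coe_norm]
    congr 1

/-- With y the signed distance of k·ω to the nearest integer, |exp(2πi y) − 1| = 2|sin πy| ≥ 4|y| by
Jordan's inequality. -/
theorem le_norm_character_sub_one {ω : Angle l} {k : Fin l → ℤ} {δ : ℝ}
    (h : ∀ p : ℤ, δ ≤ |(∑ i, (k i : ℝ) * ω i) - (p : ℝ)|) : δ ≤ ‖character k ω - 1‖ := by
  set x := ∑ i, (k i : ℝ) * ω i with hx
  refine (h (round x)).trans ?_
  have h1 : character k ω = Complex.exp (Complex.I * ((2 * Real.pi * (x - round x) : ℝ) : ℂ)) := by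
    rw [character, Complex.exp_eq_exp_iff_exists_int]
    refine ⟨round x, ?_⟩
    rw [hx]; push_cast; ring
  rw [h1, Complex.norm_exp_I_mul_ofReal_sub_one, Real.norm_eq_abs, abs_mul, abs_two]
  have h2 := abs_sub_round x
  have h3 := Real.mul_abs_le_abs_sin (x := 2 * Real.pi * (x - round x) / 2) (by
    rw [mul_assoc, mul_div_cancel_left₀ _ two_ne_zero, abs_mul, abs_of_pos Real.pi_pos]
    nlinarith [Real.pi_pos])
  rw [mul_assoc, mul_div_cancel_left₀ _ two_ne_zero, abs_mul, abs_of_pos Real.pi_pos, ← mul_assoc,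
    div_mul_cancel₀ _ Real.pi_ne_zero] at h3
  rw [mul_assoc, mul_div_cancel_left₀ _ two_ne_zero]
  linarith [abs_nonneg (x - round x)]

theorem sq_norm_le_sum_sq (k : Fin l → ℤ) : ‖k‖ ^ 2 ≤ ∑ i, (k i : ℝ) ^ 2 := by
  have h : ‖k‖ ≤ √(∑ i, (k i : ℝ) ^ 2) := by
    refine (pi_norm_le_iff_of_nonneg (Real.sqrt_nonneg _)).2 fun i => ?_
    refine Real.le_sqrt_of_sq_le ?_
    rw [Int.norm_eq_abs, sq_abs]
    exact Finset.single_le_sum (f := fun i => (k i : ℝ) ^ 2) (fun i _ => sq_nonneg _)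
      (Finset.mem_univ i)
  calc ‖k‖ ^ 2 ≤ √(∑ i, (k i : ℝ) ^ 2) ^ 2 := by gcongr
    _ = _ := Real.sq_sqrt (Finset.sum_nonneg fun i _ => sq_nonneg _)

/-- For a Diophantine rotation, the small divisors are compensated by finitely many derivatives. -/
theorem IsDiophantine.exists_kernel_coefficients {ω : Angle l} (hω : IsDiophantine ω) :
    ∃ (s : ℕ) (b : (Fin l → ℤ) → ℂ), (Summable fun k => ‖b k‖) ∧ b 0 = 0 ∧
      ∀ k ≠ 0, b k * (character k ω - 1) * (∑ i, (k i : ℂ) ^ 2) ^ s = 1 := by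
  obtain ⟨c, μ, hc, hμ, h⟩ := hω
  -- The coefficients are bounded by c⁻¹|k|^(μ−2s), which is summable once μ − 2s < −l; this choice
  -- of s is more than enough.
  obtain ⟨s, hs⟩ := exists_nat_gt (μ + l)
  have hdiv : ∀ k : Fin l → ℤ, k ≠ 0 →
      c * ‖k‖ ^ (2 * s - μ) ≤ ‖(character k ω - 1) * (∑ i, (k i : ℂ) ^ 2) ^ s‖ := by
    intro k hk
    have hk0 : 0 < ‖k‖ := norm_pos_iff.2 hk
    have h1 := le_norm_character_sub_one (h k hk)
    have h2 : ‖k‖ ^ (2 * s : ℝ) ≤ ‖(∑ i, (k i : ℂ) ^ 2) ^ s‖ := by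
      have h3 : (∑ i, (k i : ℂ) ^ 2) = ((∑ i, (k i : ℝ) ^ 2 : ℝ) : ℂ) := by push_cast; rfl
      rw [h3, norm_pow, Complex.norm_real, Real.norm_eq_abs,
        abs_of_nonneg (Finset.sum_nonneg fun i _ => sq_nonneg _)]
      have h4 : ‖k‖ ^ (2 * s : ℝ) = (‖k‖ ^ 2) ^ s := by
        rw [← pow_mul, ← Real.rpow_natCast]; push_cast; rfl
      rw [h4]
      exact pow_le_pow_left₀ (by positivity) (sq_norm_le_sum_sq k) s
    rw [norm_mul]
    calc c * ‖k‖ ^ (2 * s - μ) = (c * ‖k‖ ^ (-μ)) * ‖k‖ ^ (2 * s : ℝ) := by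
          rw [mul_assoc, ← Real.rpow_add hk0]; congr 2; ring
      _ ≤ _ := mul_le_mul h1 h2 (by positivity) (norm_nonneg _)
  refine ⟨s, fun k => if k = 0 then 0 else
    ((character k ω - 1) * (∑ i, (k i : ℂ) ^ 2) ^ s)⁻¹, ?_, by simp, fun k hk => ?_⟩
  · refine Summable.of_nonneg_of_le (fun _ => norm_nonneg _) (fun k => ?_)
      ((summable_norm_rpow_int (l := l) (μ - 2 * s) (by linarith)).mul_left c⁻¹)
    by_cases hk : k = 0
    · simp only [hk, if_true, norm_zero]; positivity
    · have hk0 : 0 < ‖k‖ := norm_pos_iff.2 hk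
      simp only [if_neg hk, norm_inv]
      have : c⁻¹ * ‖k‖ ^ (μ - 2 * s) = (c * ‖k‖ ^ (2 * s - μ))⁻¹ := by
        rw [mul_inv, ← Real.rpow_neg hk0.le, neg_sub]
      rw [this]
      exact inv_anti₀ (by positivity) (hdiv k hk)
  · have hk0 : 0 < ‖k‖ := norm_pos_iff.2 hk
    have : (character k ω - 1) * (∑ i, (k i : ℂ) ^ 2) ^ s ≠ 0 :=
      norm_pos_iff.1 ((by positivity : 0 < c * ‖k‖ ^ (2 * s - μ)).trans_le (hdiv k hk))
    simp only [if_neg hk, mul_assoc]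
    exact inv_mul_cancel₀ this

end Diophantine

/-! ### Analytic solution of the cohomological equation. -/

section Cohomological

variable {l m : ℕ} {E : Type*} [NormedAddCommGroup E] [NormedSpace ℝ E]

/-- The operator `-(4π²)⁻¹ ∑ᵢ ∂²/∂θᵢ²`. -/
noncomputable def angleLaplacian (g : Angle l × Slow m → E) (p : Angle l × Slow m) : E :=
  ∑ i, (-(1 / (4 * Real.pi ^ 2))) •
    fderiv ℝ (fun q => fderiv ℝ g q (Pi.single i 1, 0)) p (Pi.single i 1, 0)

theorem fderiv_apply_add {X : Type*} [NormedAddCommGroup X] [NormedSpace ℝ X] {g : X → E} {a : X}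
    (h : ∀ p, g (p + a) = g p) (v p : X) : fderiv ℝ g (p + a) v = fderiv ℝ g p v := by
  rw [← fderiv_comp_add_right]
  simp only [h]

theorem angleLaplacian_add {g : Angle l × Slow m → E} {a : Angle l × Slow m}
    (h : ∀ p, g (p + a) = g p) (p : Angle l × Slow m) :
    angleLaplacian g (p + a) = angleLaplacian g p := by
  unfold angleLaplacian
  refine Finset.sum_congr rfl fun i _ => ?_
  rw [fderiv_apply_add fun p => fderiv_apply_add h _ p]

theorem analyticOnNhd_fderiv_apply [CompleteSpace E] {g : Angle l × Slow m → E} {N : Set (Angle l × Slow m)}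
    (h : AnalyticOnNhd ℝ g N) (v : Angle l × Slow m) :
    AnalyticOnNhd ℝ (fun q => fderiv ℝ g q v) N := fun p hp =>
  ((ContinuousLinearMap.apply ℝ E v).analyticAt _).comp (h.fderiv p hp)

theorem analyticOnNhd_angleLaplacian [CompleteSpace E] {g : Angle l × Slow m → E} {N : Set (Angle l × Slow m)}
    (h : AnalyticOnNhd ℝ g N) : AnalyticOnNhd ℝ (angleLaplacian g) N := by
  intro p hp
  refine Finset.analyticAt_fun_sum _ fun i _ => ?_
  exact analyticAt_const.smul (analyticOnNhd_fderiv_apply (analyticOnNhd_fderiv_apply h _) _ p hp)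

theorem continuous_section {M : Set (Slow m)} {g : Angle l × Slow m → E}
    (h : AnalyticOnNhd ℝ g (univ ×ˢ M)) {J : Slow m} (hJ : J ∈ M) :
    Continuous fun θ => g (θ, J) :=
  continuous_iff_continuousAt.2 fun θ =>
    (h (θ, J) ⟨mem_univ _, hJ⟩).continuousAt.comp (f := fun θ => (θ, J)) (by fun_prop)

theorem hasDerivAt_section {M : Set (Slow m)} {g : Angle l × Slow m → E}
    (h : AnalyticOnNhd ℝ g (univ ×ˢ M)) {J : Slow m} (hJ : J ∈ M) (ℓ : E →L[ℝ] ℝ) (v θ : Angle l) :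
    HasDerivAt (fun s : ℝ => ((ℓ (g (θ + s • v, J)) : ℝ) : ℂ))
      ((ℓ (fderiv ℝ g (θ, J) (v, 0)) : ℝ) : ℂ) 0 := by
  have h1 : HasFDerivAt g (fderiv ℝ g (θ, J)) (θ + (0 : ℝ) • v, J) := by
    simpa using (h (θ, J) ⟨mem_univ _, hJ⟩).differentiableAt.hasFDerivAt
  have h2 : HasDerivAt (fun s : ℝ => (θ + s • v, J)) (v, (0 : Slow m)) 0 := by
    simpa using (((hasDerivAt_id (0 : ℝ)).smul_const v).const_add θ).prodMk (hasDerivAt_const (0 : ℝ) J)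
  have h3 := ℓ.hasFDerivAt.comp_hasDerivAt (0 : ℝ) (h1.comp_hasDerivAt (0 : ℝ) h2)
  exact h3.ofReal_comp

/-- Each second derivative multiplies the coefficient by (2πi kᵢ)², and the normalisation turns this
into exactly kᵢ². The functional `ℓ` reduces vector values to scalar Fourier coefficients. -/
theorem fourierCoefficient_angleLaplacian [CompleteSpace E] {M : Set (Slow m)} {g : Angle l × Slow m → E}
    (h : AnalyticOnNhd ℝ g (univ ×ˢ M)) (hp : ∀ p (k : Fin l → ℤ), g (p + (fun i => (k i : ℝ), 0)) = g p)
    {J : Slow m} (hJ : J ∈ M) (ℓ : E →L[ℝ] ℝ) (k : Fin l → ℤ) :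
    fourierCoefficient (fun θ => ((ℓ (angleLaplacian g (θ, J)) : ℝ) : ℂ)) k
      = (∑ i, (k i : ℂ) ^ 2) * fourierCoefficient (fun θ => ((ℓ (g (θ, J)) : ℝ) : ℂ)) k := by
  have hcont : ∀ {u : Angle l × Slow m → E}, AnalyticOnNhd ℝ u (univ ×ˢ M) →
      Continuous fun θ => ((ℓ (u (θ, J)) : ℝ) : ℂ) := fun hu =>
    Complex.continuous_ofReal.comp (ℓ.continuous.comp (continuous_section hu hJ))
  have hper : ∀ {u : Angle l × Slow m → E},
      (∀ p (k : Fin l → ℤ), u (p + (fun i => (k i : ℝ), 0)) = u p) →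
      IsTorusPeriodic fun θ => ((ℓ (u (θ, J)) : ℝ) : ℂ) := fun hu θ k => by
    have := hu (θ, J) k
    simp only [Prod.mk_add_mk, add_zero] at this
    simp only [this]
  have key : ∀ i, fourierCoefficient (fun θ => ((ℓ (fderiv ℝ (fun q => fderiv ℝ g q
      (Pi.single i 1, 0)) (θ, J) (Pi.single i 1, 0)) : ℝ) : ℂ)) k
      = (2 * Real.pi * Complex.I * k i) ^ 2 *
        fourierCoefficient (fun θ => ((ℓ (g (θ, J)) : ℝ) : ℂ)) k := by
    intro i
    have h1 := analyticOnNhd_fderiv_apply h (Pi.single i 1, 0)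
    have h2 := analyticOnNhd_fderiv_apply h1 (Pi.single i 1, 0)
    rw [fourierCoefficient_lineDeriv (hcont h1) (hcont h2)
      (hper (u := fun q => fderiv ℝ g q (Pi.single i 1, 0))
        fun p k => fderiv_apply_add (fun p => hp p k) _ p) i
      (fun θ => hasDerivAt_section h1 hJ ℓ _ θ) k,
      fourierCoefficient_lineDeriv (hcont h) (hcont h1) (hper hp) i
      (fun θ => hasDerivAt_section h hJ ℓ _ θ) k]
    ring
  have hsum : ∀ θ, ((ℓ (angleLaplacian g (θ, J)) : ℝ) : ℂ) = ∑ i, (-(1 / (4 * Real.pi ^ 2)) : ℂ) *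
      ((ℓ (fderiv ℝ (fun q => fderiv ℝ g q (Pi.single i 1, 0)) (θ, J) (Pi.single i 1, 0)) : ℝ) : ℂ) := by
    intro θ
    simp [angleLaplacian, map_sum]
  rw [fourierCoefficient]
  simp only [hsum, Finset.mul_sum]
  rw [integral_finsetSum, Finset.sum_mul]
  · refine Finset.sum_congr rfl fun i _ => ?_
    have h3 := key i
    rw [fourierCoefficient] at h3
    simp only [mul_left_comm (character _ _)]
    rw [integral_const_mul, h3]
    have : (Real.pi : ℂ) ≠ 0 := by exact_mod_cast Real.pi_ne_zero
    field_simp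
    rw [Complex.I_sq]; ring
  · intro i _
    have h1 := analyticOnNhd_fderiv_apply h (Pi.single i 1, 0)
    have h2 := hcont (analyticOnNhd_fderiv_apply h1 (Pi.single i 1, 0))
    have := continuous_character (-k)
    exact (Continuous.continuousOn (by fun_prop)).integrableOn_compact isCompact_Icc

/-- The cohomological equation over a Diophantine rotation has an analytic solution. -/
theorem IsDiophantine.exists_cohomological_solution [CompleteSpace E] {ω : Angle l}
    (hω : IsDiophantine ω) {M : Set (Slow m)} {g : Angle l → Slow m → E}
    (hg : IsAnalyticOnTorus M g) :
    ∃ T : Angle l → Slow m → E, IsAnalyticOnTorus M T ∧ ∀ J ∈ M, ∀ θ,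
      T (θ + ω) J - T θ J = g θ J - ∫ t in Icc (0 : Angle l) 1, g t J := by
  obtain ⟨s, b, hb, hb0, hbd⟩ := hω.exists_kernel_coefficients
  set G : Angle l × Slow m → E := fun p => g p.1 p.2 with hG
  set H : ℕ → Angle l × Slow m → E := fun n => angleLaplacian^[n] G with hH
  have hHs : ∀ n, H (n + 1) = angleLaplacian (H n) := fun n => Function.iterate_succ_apply' _ _ _
  have hper : ∀ n p (k : Fin l → ℤ), H n (p + (fun i => (k i : ℝ), 0)) = H n p := by
    intro n
    induction n with
    | zero => intro p k; simpa [hH, hG] using hg.1 p.2 p.1 k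
    | succ n ih => intro p k; rw [hHs]; exact angleLaplacian_add (fun p => ih p k) p
  have hana : ∀ n, AnalyticOnNhd ℝ (H n) (univ ×ˢ M) := by
    intro n
    induction n with
    | zero => exact hg.2
    | succ n ih => rw [hHs]; exact analyticOnNhd_angleLaplacian ih
  have hper' : ∀ n J, IsTorusPeriodic fun θ => H n (θ, J) := fun n J θ k => by
    have := hper n (θ, J) k
    simp only [Prod.mk_add_mk, add_zero] at this
    exact this
  have hcoef : ∀ n, ∀ J ∈ M, ∀ (ℓ : E →L[ℝ] ℝ) k,
      fourierCoefficient (fun θ => ((ℓ (H n (θ, J)) : ℝ) : ℂ)) k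
      = (∑ i, (k i : ℂ) ^ 2) ^ n * fourierCoefficient (fun θ => ((ℓ (G (θ, J)) : ℝ) : ℂ)) k := by
    intro n J hJ ℓ k
    induction n with
    | zero => simp [hH]
    | succ n ih =>
      rw [hHs, fourierCoefficient_angleLaplacian (hana n) (hper n) hJ, ih]; ring
  set K : Angle l → ℂ := fun t => ∑' k, b k * character (-k) t with hK
  have hKc : Continuous K := by
    refine continuous_tsum (fun k => continuous_const.mul (continuous_character _)) hb fun k t => ?_
    rw [norm_mul, norm_character, mul_one]
  have hKr : Continuous fun t => (K t).re := Complex.continuous_re.comp hKc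
  -- Convolution of the `s`-th Laplacian power with the kernel. The real part suffices because the
  -- data are real, and analyticity needs only continuity of the kernel.
  refine ⟨fun θ J => ∫ t in Icc (0 : Angle l) 1, (K t).re • H s (θ + t, J), ⟨?_, ?_⟩, ?_⟩
  · intro J θ k
    refine setIntegral_congr_fun measurableSet_cube fun t _ => ?_
    have := hper' s J (θ + t) k
    simp only at this
    simp only [add_right_comm θ _ t, this]
  · intro p hp
    refine analyticAt_setIntegral (f := fun q : Angle l × (Angle l × Slow m) =>
      H s (q.2.1 + q.1, q.2.2)) isCompact_Icc hKr fun t _ => ?_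
    have h1 : AnalyticAt ℝ (H s) (p.1 + t, p.2) := hana s _ ⟨mem_univ _, hp.2⟩
    exact h1.fun_comp (f := fun q : Angle l × (Angle l × Slow m) => (q.2.1 + q.1, q.2.2))
      (x := (t, p)) (((analyticAt_fst.comp analyticAt_snd).add analyticAt_fst).prod
        (analyticAt_snd.comp analyticAt_snd))
  · intro J hJ θ
    refine (SeparatingDual.eq_iff_forall_dual_eq (R := ℝ)).2 fun ℓ => ?_
    have hc : ∀ n, Continuous fun θ => ((ℓ (H n (θ, J)) : ℝ) : ℂ) := fun n =>
      Complex.continuous_ofReal.comp (ℓ.continuous.comp (continuous_section (hana n) hJ))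
    have hp : ∀ n, IsTorusPeriodic fun θ => ((ℓ (H n (θ, J)) : ℝ) : ℂ) := fun n θ k => by
      have := hper' n J θ k
      simp only at this
      simp only [this]
    have h1 := cohomological_kernel hb hb0 hbd (hc 0) (hp 0) (hc s) (hp s)
      (fun k => hcoef s J hJ ℓ k) θ
    have hint : ∀ θ, ((ℓ (∫ t in Icc (0 : Angle l) 1, (K t).re • H s (θ + t, J)) : ℝ))
        = (∫ t in Icc (0 : Angle l) 1, K t * ((ℓ (H s (θ + t, J)) : ℝ) : ℂ)).re := by
      intro θ
      have hcs := continuous_section (hana s) hJ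
      have hcs' : Continuous fun t => H s (θ + t, J) := hcs.comp (continuous_const.add continuous_id)
      rw [← ℓ.integral_comp_comm, ← Complex.reCLM_apply, ← Complex.reCLM.integral_comp_comm]
      · refine setIntegral_congr_fun measurableSet_cube fun t _ => ?_
        simp
      · exact (hKc.mul (Complex.continuous_ofReal.comp (ℓ.continuous.comp hcs'))).continuousOn.integrableOn_compact
          isCompact_Icc
      · exact (hKr.smul hcs').continuousOn.integrableOn_compact isCompact_Icc
    have h2 := congrArg Complex.re h1
    rw [Complex.sub_re, ← hint, ← hint, Complex.sub_re, integral_complex_ofReal, Complex.ofReal_re,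
      Complex.ofReal_re, ℓ.integral_comp_comm] at h2
    · rw [map_sub, map_sub, h2]; rfl
    · exact (continuous_section hg.2 hJ).continuousOn.integrableOn_compact isCompact_Icc

end Cohomological

end SlowFast

namespace SlowFast

/-! ### The remainder left by one decoupling step. -/

section Remainder

open scoped ContDiff

variable {X : Type*} [NormedAddCommGroup X] [NormedSpace ℝ X] [CompleteSpace X]

/-- A globally chosen small solution `ζ` of `ζ = κ ^ j • Ψ (x, κ, ζ)`, if there is one. -/
noncomputable def smallSolution (Ψ : (X × ℝ) × X → X) (j : ℕ) (p : X × ℝ) : X :=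
  Classical.epsilon fun ζ => ζ = p.2 ^ j • Ψ (p, ζ) ∧ ‖ζ‖ ^ 2 ≤ |p.2|

-- The conditions selecting the solution involve x only through `Ψ`, so the choice inherits every
-- period of `Ψ`. Solutions chosen locally would have to be matched across translates.
omit [CompleteSpace X] in
theorem smallSolution_add {Ψ : (X × ℝ) × X → X} {a : X} (h : ∀ x κ ζ, Ψ ((x + a, κ), ζ) = Ψ ((x, κ), ζ))
    (j : ℕ) (x : X) (κ : ℝ) : smallSolution Ψ j (x + a, κ) = smallSolution Ψ j (x, κ) := by
  simp only [smallSolution, h]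

/-- At κ = 0 the equation reads ζ = 0, so the implicit function theorem gives a unique local
analytic solution. It is O(κ) and hence satisfies ‖ζ‖² ≤ |κ|; conversely this bound forces every
admissible ζ into the uniqueness neighbourhood for small κ. The global choice therefore agrees with
the analytic one near (x₀, 0). -/
theorem smallSolution_spec {Ψ : (X × ℝ) × X → X} {j : ℕ} (hj : j ≠ 0) {x₀ : X}
    (hΨ : AnalyticAt ℝ Ψ ((x₀, 0), 0)) :
    AnalyticAt ℝ (smallSolution Ψ j) (x₀, 0) ∧ smallSolution Ψ j (x₀, 0) = 0 ∧
      ∀ᶠ p in 𝓝 (x₀, (0 : ℝ)), smallSolution Ψ j p = p.2 ^ j • Ψ (p, smallSolution Ψ j p) := by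
  set f : (X × ℝ) × X → X := fun q => q.2 - q.1.2 ^ j • Ψ q with hf
  have hfa : AnalyticAt ℝ f ((x₀, 0), 0) :=
    analyticAt_snd.sub (((analyticAt_snd.comp analyticAt_fst).pow j).smul hΨ)
  have hcd : ContDiffAt ℝ ω f ((x₀, 0), 0) := hfa.contDiffAt
  have hf0 : f ((x₀, 0), 0) = 0 := by simp [hf, hj]
  have hid : fderiv ℝ f ((x₀, 0), 0) ∘L .inr ℝ (X × ℝ) X = .id ℝ X := by
    have h1 : HasFDerivAt (fun ζ : X => f ((x₀, 0), ζ))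
        (fderiv ℝ f ((x₀, 0), 0) ∘L .inr ℝ (X × ℝ) X) 0 :=
      hfa.differentiableAt.hasFDerivAt.comp (0 : X) (hasFDerivAt_prodMk_right (x₀, (0 : ℝ)) (0 : X))
    have h2 : (fun ζ : X => f ((x₀, 0), ζ)) = id := by ext ζ; simp [hf, hj]
    rw [h2] at h1
    exact h1.unique (hasFDerivAt_id 0)
  have hinv : (fderiv ℝ f ((x₀, 0), 0) ∘L .inr ℝ (X × ℝ) X).IsInvertible := by
    rw [hid]; exact ⟨ContinuousLinearEquiv.refl ℝ X, rfl⟩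
  set φ := hcd.implicitFunction (by simp) hinv with hφ
  have hφa : AnalyticAt ℝ φ (x₀, 0) :=
    (hcd.contDiffAt_implicitFunction (by simp) hinv).analyticAt
  have hφ0 : φ (x₀, 0) = 0 := hcd.implicitFunction_apply_self (by simp) hinv
  have hφs : ∀ᶠ p in 𝓝 (x₀, (0 : ℝ)), f (p, φ p) = 0 := by
    have := hcd.eventually_apply_implicitFunction (by simp) hinv
    rwa [hf0] at this
  have hφu : ∀ᶠ v in 𝓝 ((x₀, (0 : ℝ)), (0 : X)), f v = 0 → φ v.1 = v.2 := by
    have := hcd.eventually_apply_eq_iff_implicitFunction (by simp) hinv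
    rw [hf0] at this
    exact this.mono fun _ h => h.1
  have hpair : ContinuousAt (fun p => (p, φ p)) (x₀, (0 : ℝ)) := continuousAt_id.prodMk hφa.continuousAt
  have hbd : ∀ᶠ p in 𝓝 (x₀, (0 : ℝ)), ‖Ψ (p, φ p)‖ < ‖Ψ ((x₀, 0), 0)‖ + 1 := by
    have h1 : ContinuousAt (fun p => ‖Ψ (p, φ p)‖) (x₀, (0 : ℝ)) := by
      have h2 : ContinuousAt Ψ ((x₀, 0), φ (x₀, 0)) := by rw [hφ0]; exact hΨ.continuousAt
      exact (ContinuousAt.comp (f := fun p => (p, φ p)) h2 hpair).norm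
    have h3 := h1.tendsto.eventually_lt_const (u := ‖Ψ ((x₀, 0), 0)‖ + 1) (by rw [hφ0]; linarith)
    exact h3
  set B := ‖Ψ ((x₀, 0), 0)‖ + 1 with hB
  have hB0 : 0 < B := by positivity
  have hκ : ∀ᶠ p in 𝓝 (x₀, (0 : ℝ)), |p.2| < 1 ∧ B ^ 2 * |p.2| < 1 := by
    have h1 : ContinuousAt (fun p : X × ℝ => |p.2|) (x₀, (0 : ℝ)) := by fun_prop
    have h2 : ContinuousAt (fun p : X × ℝ => B ^ 2 * |p.2|) (x₀, (0 : ℝ)) := by fun_prop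
    exact (h1.tendsto.eventually_lt_const (by simp)).and (h2.tendsto.eventually_lt_const (by simp))
  have hex : ∀ᶠ p in 𝓝 (x₀, (0 : ℝ)), φ p = p.2 ^ j • Ψ (p, φ p) ∧ ‖φ p‖ ^ 2 ≤ |p.2| := by
    filter_upwards [hφs, hbd, hκ] with p h1 h2 h3
    have h4 : φ p = p.2 ^ j • Ψ (p, φ p) := sub_eq_zero.1 h1
    refine ⟨h4, ?_⟩
    have h5 : ‖φ p‖ ≤ |p.2| * B := by
      rw [h4, norm_smul, norm_pow, Real.norm_eq_abs]
      exact mul_le_mul (pow_le_of_le_one (abs_nonneg _) h3.1.le hj) h2.le (norm_nonneg _) (abs_nonneg _)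
    calc ‖φ p‖ ^ 2 ≤ (|p.2| * B) ^ 2 := by gcongr
      _ = |p.2| * (B ^ 2 * |p.2|) := by ring
      _ ≤ |p.2| * 1 := by gcongr; exact h3.2.le
      _ = |p.2| := mul_one _
  obtain ⟨W, hW, R, hR, hWR⟩ := Filter.eventually_prod_iff.1 (by rwa [nhds_prod_eq] at hφu)
  obtain ⟨ε, hε, hεR⟩ := Metric.eventually_nhds_iff.1 hR
  have hsmall : ∀ᶠ p in 𝓝 (x₀, (0 : ℝ)), |p.2| < ε ^ 2 := by
    have h1 : ContinuousAt (fun p : X × ℝ => |p.2|) (x₀, (0 : ℝ)) := by fun_prop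
    exact h1.tendsto.eventually_lt_const (by simpa using by positivity)
  have heq : ∀ᶠ p in 𝓝 (x₀, (0 : ℝ)), φ p = smallSolution Ψ j p := by
    filter_upwards [hex, hW, hsmall] with p h1 h2 h3
    have h4 : ∃ ζ, ζ = p.2 ^ j • Ψ (p, ζ) ∧ ‖ζ‖ ^ 2 ≤ |p.2| := ⟨_, h1⟩
    have h5 := Classical.epsilon_spec h4
    refine hWR h2 (hεR ?_) (sub_eq_zero.2 h5.1)
    rw [dist_zero_right]
    exact lt_of_pow_lt_pow_left₀ 2 hε.le (h5.2.trans_lt h3)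
  refine ⟨hφa.congr heq, by rw [← heq.self_of_nhds, hφ0], ?_⟩
  filter_upwards [hex, heq] with p h1 h2
  rw [← h2]; exact h1.1

/-- The remainder of the conjugated map: if `τ` solves the linearised conjugacy equation at
order `κ ^ j`, then `y ↦ y + κ ^ j • τ y` removes the angle dependence at that order. -/
theorem exists_conjugacy_remainder {N : Set X} (hN : IsOpen N) {Ω : X} (hNΩ : ∀ x ∈ N, x + Ω ∈ N)
    {j : ℕ} (hj : j ≠ 0) {B A : X × ℝ → X} {Abar τ : X → X}
    (hB : ∀ x ∈ N, AnalyticAt ℝ B (x, 0)) (hA : ∀ x ∈ N, AnalyticAt ℝ A (x, 0))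
    (hAbar : AnalyticOnNhd ℝ Abar N) (hτ : AnalyticOnNhd ℝ τ N)
    (hcoh : ∀ x ∈ N, A (x, 0) = Abar x + τ (x + Ω) - τ x) :
    ∃ R : X × ℝ → X, (∀ a : X, (∀ x κ, B (x + a, κ) = B (x, κ)) → (∀ x κ, A (x + a, κ) = A (x, κ)) →
        (∀ x, Abar (x + a) = Abar x) → (∀ x, τ (x + a) = τ x) → ∀ x κ, R (x + a, κ) = R (x, κ)) ∧
      (∀ x ∈ N, AnalyticAt ℝ R (x, 0)) ∧
      ∀ x ∈ N, ∀ᶠ p in 𝓝 (x, (0 : ℝ)), ∀ u z, u = p.1 + p.2 ^ j • τ p.1 →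
        z = p.1 + Ω + p.2 • B p + p.2 ^ j • Abar p.1 + p.2 ^ (j + 1) • R p →
        u + Ω + p.2 • B (u, p.2) + p.2 ^ j • A (u, p.2) = z + p.2 ^ j • τ z := by
  -- Cancelling the common terms in the conjugacy and using `hcoh`, the required remainder is R = D₁
  -- + D₂: `D₁` comes from B(u) − B(x), which is divisible by κ^j, and `D₂` from A(u) − τ(z) minus
  -- its value at κ = 0, which is divisible by κ. Since z contains R, `D₂` takes ζ = κ^j R as an
  -- extra argument, and ζ = κ^j Ψ(x, κ, ζ) follows.
  set D₁ : (X × ℝ) × ℝ → X :=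
    fun q => dslope (fun s => B (q.1.1 + s • τ q.1.1, q.1.2)) 0 q.2 with hD₁
  set D₂ : (X × X) × ℝ → X := fun q => dslope (fun s => A (q.1.1 + s ^ j • τ q.1.1, s) -
    τ (q.1.1 + Ω + s • (B (q.1.1, s) + s ^ (j - 1) • Abar q.1.1 + q.1.2))) 0 q.2 with hD₂
  set Ψ : (X × ℝ) × X → X := fun q => D₁ (q.1, q.1.2 ^ j) + D₂ ((q.1.1, q.2), q.1.2) with hΨ
  have hD₁a : ∀ x ∈ N, AnalyticAt ℝ D₁ ((x, 0), 0) := by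
    intro x hx
    refine analyticAt_dslope (f := fun q : (X × ℝ) × ℝ => B (q.1.1 + q.2 • τ q.1.1, q.1.2)) ?_
    have h1 : AnalyticAt ℝ (fun q : (X × ℝ) × ℝ => τ q.1.1) ((x, 0), 0) :=
      (hτ x hx).fun_comp (f := fun q : (X × ℝ) × ℝ => q.1.1) (x := ((x, 0), 0))
        (analyticAt_fst.comp analyticAt_fst)
    have h2 : AnalyticAt ℝ B (x + (0 : ℝ) • τ x, 0) := by simpa using hB x hx
    exact h2.fun_comp (f := fun q : (X × ℝ) × ℝ => (q.1.1 + q.2 • τ q.1.1, q.1.2))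
      (x := ((x, 0), 0)) (((analyticAt_fst.comp analyticAt_fst).add (analyticAt_snd.smul h1)).prod
        (analyticAt_snd.comp analyticAt_fst))
  have hD₂a : ∀ x ∈ N, AnalyticAt ℝ D₂ ((x, 0), 0) := by
    intro x hx
    refine analyticAt_dslope (f := fun q : (X × X) × ℝ => A (q.1.1 + q.2 ^ j • τ q.1.1, q.2) -
      τ (q.1.1 + Ω + q.2 • (B (q.1.1, q.2) + q.2 ^ (j - 1) • Abar q.1.1 + q.1.2))) ?_
    have hfst : AnalyticAt ℝ (fun q : (X × X) × ℝ => q.1.1) ((x, 0), 0) :=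
      analyticAt_fst.comp analyticAt_fst
    have h1 : AnalyticAt ℝ (fun q : (X × X) × ℝ => τ q.1.1) ((x, 0), 0) :=
      (hτ x hx).fun_comp (x := ((x, 0), 0)) hfst
    have h2 : AnalyticAt ℝ (fun q : (X × X) × ℝ => Abar q.1.1) ((x, 0), 0) :=
      (hAbar x hx).fun_comp (x := ((x, 0), 0)) hfst
    have h3 : AnalyticAt ℝ A (x + (0 : ℝ) ^ j • τ x, 0) := by simpa [hj] using hA x hx
    have h4 : AnalyticAt ℝ (fun q : (X × X) × ℝ => A (q.1.1 + q.2 ^ j • τ q.1.1, q.2)) ((x, 0), 0) :=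
      h3.fun_comp (f := fun q : (X × X) × ℝ => (q.1.1 + q.2 ^ j • τ q.1.1, q.2)) (x := ((x, 0), 0))
        ((hfst.add ((analyticAt_snd.pow j).smul h1)).prod analyticAt_snd)
    have h5 : AnalyticAt ℝ (fun q : (X × X) × ℝ => B (q.1.1, q.2)) ((x, 0), 0) :=
      (hB x hx).fun_comp (f := fun q : (X × X) × ℝ => (q.1.1, q.2)) (x := ((x, 0), 0))
        (hfst.prod analyticAt_snd)
    have h6 : AnalyticAt ℝ (fun q : (X × X) × ℝ => q.1.1 + Ω +
        q.2 • (B (q.1.1, q.2) + q.2 ^ (j - 1) • Abar q.1.1 + q.1.2)) ((x, 0), 0) :=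
      (hfst.add analyticAt_const).add (analyticAt_snd.smul
        ((h5.add ((analyticAt_snd.pow (j - 1)).smul h2)).add (analyticAt_snd.comp analyticAt_fst)))
    refine h4.sub (AnalyticAt.fun_comp (g := τ) ?_ h6)
    simpa using hτ _ (hNΩ x hx)
  have hΨa : ∀ x ∈ N, AnalyticAt ℝ Ψ ((x, 0), 0) := by
    intro x hx
    have h1 : AnalyticAt ℝ D₁ ((x, 0), (0 : ℝ) ^ j) := by simpa [hj] using hD₁a x hx
    refine (h1.fun_comp (f := fun q : (X × ℝ) × X => (q.1, q.1.2 ^ j)) (x := ((x, 0), 0))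
      (analyticAt_fst.prod ((analyticAt_snd.comp analyticAt_fst).pow j))).add ?_
    exact (hD₂a x hx).fun_comp (f := fun q : (X × ℝ) × X => ((q.1.1, q.2), q.1.2))
      (x := ((x, 0), 0)) (((analyticAt_fst.comp analyticAt_fst).prod analyticAt_snd).prod
        (analyticAt_snd.comp analyticAt_fst))
  refine ⟨fun p => Ψ (p, smallSolution Ψ j p), ?_, ?_, ?_⟩
  · intro a haB haA haAbar haτ x κ
    have h1 : ∀ x κ ζ, Ψ ((x + a, κ), ζ) = Ψ ((x, κ), ζ) := by
      intro x κ ζ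
      simp only [hΨ, hD₁, hD₂, haτ, haAbar, add_right_comm _ a, haB, haA]
    simp only [smallSolution_add h1, h1]
  · intro x hx
    obtain ⟨h1, h2, -⟩ := smallSolution_spec hj (hΨa x hx)
    refine AnalyticAt.fun_comp (g := Ψ) (f := fun p => (p, smallSolution Ψ j p)) ?_
      (analyticAt_id.prod h1)
    rw [h2]; exact hΨa x hx
  · intro x hx
    obtain ⟨-, -, h3⟩ := smallSolution_spec hj (hΨa x hx)
    have hN' : ∀ᶠ p in 𝓝 (x, (0 : ℝ)), p.1 ∈ N :=
      continuousAt_fst.eventually (hN.mem_nhds hx)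
    filter_upwards [h3, hN'] with p hp hpN u z hu hz
    set ζ := smallSolution Ψ j p with hζ
    set κ := p.2 with hκ
    have e1 : B (u, κ) - B p = κ ^ j • D₁ (p, κ ^ j) := by
      have := sub_smul_dslope (fun s => B (p.1 + s • τ p.1, p.2)) 0 (κ ^ j)
      simp only [sub_zero, zero_smul, add_zero] at this
      rw [hu]
      exact this.symm
    have e2 : A (u, κ) - τ z - (A (p.1, 0) - τ (p.1 + Ω)) = κ • D₂ ((p.1, ζ), κ) := by
      have h4 := sub_smul_dslope (fun s => A (p.1 + s ^ j • τ p.1, s) -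
        τ (p.1 + Ω + s • (B (p.1, s) + s ^ (j - 1) • Abar p.1 + ζ))) 0 κ
      simp only [sub_zero, zero_smul, add_zero, zero_pow hj] at h4
      -- The remainder term of z is κ^(j+1) R = κ ζ, so z is the point at which τ is evaluated in
      -- `D₂`.
      have h5 : z = p.1 + Ω + κ • (B (p.1, κ) + κ ^ (j - 1) • Abar p.1 + ζ) := by
        have h6 : κ ^ (j + 1) • Ψ (p, ζ) = κ • ζ := by rw [pow_succ', mul_smul, ← hp]
        have h7 : κ ^ j • Abar p.1 = κ • κ ^ (j - 1) • Abar p.1 := by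
          rw [smul_smul, ← pow_succ', Nat.sub_add_cancel (Nat.one_le_iff_ne_zero.2 hj)]
        rw [hz, h6, h7, smul_add, smul_add, ← add_assoc, ← add_assoc]
      rw [hu, h5]
      exact h4.symm
    have e3 : Ψ (p, ζ) = D₁ (p, κ ^ j) + D₂ ((p.1, ζ), κ) := rfl
    have e4 : A (u, κ) = τ z - τ p.1 + Abar p.1 + κ • D₂ ((p.1, ζ), κ) := by
      rw [← e2, hcoh p.1 hpN]; abel
    have e5 : B (u, κ) = B p + κ ^ j • D₁ (p, κ ^ j) := by rw [← e1]; abel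
    linear_combination (norm := module) hu + κ • e5 + κ ^ j • e4 - hz - κ ^ (j + 1) • e3

end Remainder

end SlowFast

/-! ### Uniformity over the torus, algebra of the decoupled maps, and existence of decoupling
sequences. -/

namespace SlowFast

variable {l m : ℕ}

/-- The lattice translations of the lifted phase space. -/
def latticeShift (k : Fin l → ℤ) : Angle l × Slow m := (fun i => (k i : ℝ), 0)

/-- A property that is invariant under lattice translations and holds near each point of
(unit cube) × `C` for small `κ` holds for small `κ` uniformly on (torus) × `C`. -/
theorem eventually_forall_torus_of_cube {P : Angle l × Slow m → ℝ → Prop} {C : Set (Slow m)}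
    (hC : IsCompact C) (hper : ∀ x κ k, P (x + latticeShift k) κ → P x κ)
    (hloc : ∀ x ∈ Icc (0 : Angle l) 1 ×ˢ C, ∀ᶠ p in 𝓝 (x, (0 : ℝ)), P p.1 p.2) :
    ∀ᶠ κ in 𝓝 (0 : ℝ), ∀ x ∈ (univ : Set (Angle l)) ×ˢ C, P x κ := by
  have hQ : IsCompact (Icc (0 : Angle l) 1 ×ˢ C) := isCompact_Icc.prod hC
  have h := hQ.eventually_forall_of_forall_eventually (x₀ := (0 : ℝ)) (P := fun κ x => P x κ)
    fun x hx => (continuous_swap.tendsto ((0 : ℝ), x)).eventually (hloc x hx)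
  filter_upwards [h] with κ hκ x hx
  refine hper x κ (fun i => -⌊x.1 i⌋) (hκ _ ⟨⟨fun i => ?_, fun i => ?_⟩, ?_⟩)
  · have := Int.floor_le (x.1 i)
    simpa [latticeShift] using this
  · have := (Int.lt_floor_add_one (x.1 i)).le
    simp [latticeShift]
    linarith
  · simpa [latticeShift] using hx.2

theorem eventually_forall_torus {P : Angle l × Slow m → ℝ → Prop} {C : Set (Slow m)}
    (hC : IsCompact C) (hper : ∀ x κ k, P (x + latticeShift k) κ → P x κ)
    (hloc : ∀ x ∈ (univ : Set (Angle l)) ×ˢ C, ∀ᶠ p in 𝓝 (x, (0 : ℝ)), P p.1 p.2) :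
    ∀ᶠ κ in 𝓝 (0 : ℝ), ∀ x ∈ (univ : Set (Angle l)) ×ˢ C, P x κ :=
  eventually_forall_torus_of_cube hC hper fun x hx => hloc x ⟨mem_univ _, hx.2⟩

theorem IsAnalyticFamily.analyticOnNhd_angleAverage {E : Type*} [NormedAddCommGroup E]
    [NormedSpace ℝ E] [CompleteSpace E] {M : Set (Slow m)} {g : Angle l → Slow m → ℝ → E}
    (hg : IsAnalyticFamily M g) : AnalyticOnNhd ℝ (angleAverage g) M := by
  intro J hJ
  have h := analyticAt_setIntegral (ν := (volume : Measure (Angle l)))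
    (f := fun q : Angle l × Slow m => g q.1 q.2 0) (x₀ := J) (w := fun _ => 1)
    (isCompact_Icc (a := (0 : Angle l)) (b := 1)) continuous_const fun t _ => ?_
  · simp only [one_smul] at h
    exact h
  · exact (hg.2 (t, J, 0) ⟨mem_univ _, hJ, rfl⟩).fun_comp (x := (t, J))
      (f := fun q : Angle l × Slow m => (q.1, q.2, (0 : ℝ)))
      (analyticAt_fst.prod (analyticAt_snd.prod analyticAt_const))

theorem IsAnalyticFamily.isAnalyticOnTorus {E : Type*} [NormedAddCommGroup E]
    [NormedSpace ℝ E] {M : Set (Slow m)} {g : Angle l → Slow m → ℝ → E}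
    (hg : IsAnalyticFamily M g) : IsAnalyticOnTorus M fun θ J => g θ J 0 :=
  ⟨fun J => hg.1 J 0, fun p hp => (hg.2 (p.1, p.2, 0) ⟨mem_univ _, hp.2, rfl⟩).fun_comp (x := p)
      (f := fun q : Angle l × Slow m => (q.1, q.2, (0 : ℝ)))
      (analyticAt_fst.prod (analyticAt_snd.prod analyticAt_const))⟩

namespace DecouplingData

/-- The pair `(F^(j), G^(j))`. -/
def remainder (D : DecouplingData l m) (j : ℕ) (p : (Angle l × Slow m) × ℝ) : Angle l × Slow m :=
  (D.F j p.1.1 p.1.2 p.2, D.G j p.1.1 p.1.2 p.2)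

/-- The averaged pair `(F̄^(j), Ḡ^(j))`. -/
noncomputable def averaged (D : DecouplingData l m) (j : ℕ) (x : Angle l × Slow m) :
    Angle l × Slow m :=
  (angleAverage (D.F j) x.2, angleAverage (D.G j) x.2)

/-- The pair `(T^(j), S^(j))`. -/
def generator (D : DecouplingData l m) (j : ℕ) (x : Angle l × Slow m) : Angle l × Slow m :=
  (D.T j x.1 x.2, D.S j x.1 x.2)

/-- The sum `∑_{i=1}^{j-1} κ^(i-1) (F̄^(i), Ḡ^(i))`. -/
noncomputable def averagedSum (D : DecouplingData l m) (j : ℕ) (p : (Angle l × Slow m) × ℝ) :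
    Angle l × Slow m :=
  ∑ i ∈ Finset.Ico 1 j, p.2 ^ (i - 1) • D.averaged i p.1

variable {D D' : DecouplingData l m} {ω₀ : Angle l} {M : Set (Slow m)}

theorem step_eq (j : ℕ) (κ : ℝ) (x : Angle l × Slow m) :
    D.step j κ x = x + κ ^ j • D.generator j x := rfl

theorem smul_averagedSum (j : ℕ) (κ : ℝ) (x : Angle l × Slow m) :
    κ • D.averagedSum j (x, κ) = ∑ i ∈ Finset.Ico 1 j, κ ^ i • D.averaged i x := by
  rw [averagedSum, Finset.smul_sum]
  refine Finset.sum_congr rfl fun i hi => ?_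
  rw [smul_smul, ← pow_succ', Nat.sub_add_cancel (Finset.mem_Ico.1 hi).1]

/-- Shape x + Ω + κB + κ^j A expected by `exists_conjugacy_remainder`; the exponent i − 1 in
`averagedSum` comes from factoring out one κ. -/
theorem normalForm_eq (j : ℕ) (κ : ℝ) (x : Angle l × Slow m) :
    D.normalForm ω₀ j κ x
      = x + (ω₀, 0) + κ • D.averagedSum j (x, κ) + κ ^ j • D.remainder j (x, κ) := by
  rw [smul_averagedSum]
  refine Prod.ext ?_ ?_
  · simp [normalForm, remainder, averaged, Prod.fst_sum]
  · simp [normalForm, remainder, averaged, Prod.snd_sum]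

theorem averagedSum_succ {j : ℕ} (hj : 1 ≤ j) (κ : ℝ) (x : Angle l × Slow m) :
    κ • D.averagedSum (j + 1) (x, κ) = κ • D.averagedSum j (x, κ) + κ ^ j • D.averaged j x := by
  rw [smul_averagedSum, smul_averagedSum, Finset.sum_Ico_succ_top hj]

theorem normalForm_congr {j : ℕ} (hF : ∀ i ≤ j, D.F i = D'.F i) (hG : ∀ i ≤ j, D.G i = D'.G i) :
    D.normalForm ω₀ j = D'.normalForm ω₀ j := by
  ext1 κ; ext1 x
  have h1 : ∀ i ∈ Finset.Ico 1 j, κ ^ i • angleAverage (D.F i) x.2 = κ ^ i • angleAverage (D'.F i) x.2 :=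
    fun i hi => by rw [hF i (Finset.mem_Ico.1 hi).2.le]
  have h2 : ∀ i ∈ Finset.Ico 1 j, κ ^ i • angleAverage (D.G i) x.2 = κ ^ i • angleAverage (D'.G i) x.2 :=
    fun i hi => by rw [hG i (Finset.mem_Ico.1 hi).2.le]
  rw [normalForm, normalForm, Finset.sum_congr rfl h1, Finset.sum_congr rfl h2, hF j le_rfl,
    hG j le_rfl]

theorem averaged_add_latticeShift (j : ℕ) (x : Angle l × Slow m) (k : Fin l → ℤ) :
    D.averaged j (x + latticeShift k) = D.averaged j x := by
  simp [averaged, latticeShift]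

theorem averagedSum_add_latticeShift (j : ℕ) (κ : ℝ) (x : Angle l × Slow m) (k : Fin l → ℤ) :
    D.averagedSum j (x + latticeShift k, κ) = D.averagedSum j (x, κ) := by
  simp only [averagedSum, averaged_add_latticeShift]

theorem remainder_add_latticeShift {j : ℕ} (hF : IsAnalyticFamily M (D.F j))
    (hG : IsAnalyticFamily M (D.G j)) (κ : ℝ) (x : Angle l × Slow m) (k : Fin l → ℤ) :
    D.remainder j (x + latticeShift k, κ) = D.remainder j (x, κ) := by
  have h1 := hF.1 x.2 κ x.1 k
  have h2 := hG.1 x.2 κ x.1 k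
  simp only at h1 h2
  simp only [remainder, latticeShift, Prod.fst_add, Prod.snd_add, add_zero, h1, h2]

theorem generator_add_latticeShift {j : ℕ} (hT : IsAnalyticOnTorus M (D.T j))
    (hS : IsAnalyticOnTorus M (D.S j)) (x : Angle l × Slow m) (k : Fin l → ℤ) :
    D.generator j (x + latticeShift k) = D.generator j x := by
  have h1 := hT.1 x.2 x.1 k
  have h2 := hS.1 x.2 x.1 k
  simp only at h1 h2
  simp only [generator, latticeShift, Prod.fst_add, Prod.snd_add, add_zero, h1, h2]

theorem normalForm_add_latticeShift {j : ℕ} (hF : IsAnalyticFamily M (D.F j))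
    (hG : IsAnalyticFamily M (D.G j)) (κ : ℝ) (x : Angle l × Slow m) (k : Fin l → ℤ) :
    D.normalForm ω₀ j κ (x + latticeShift k) = D.normalForm ω₀ j κ x + latticeShift k := by
  simp only [normalForm_eq, averagedSum_add_latticeShift, remainder_add_latticeShift hF hG]
  abel

theorem step_add_latticeShift {j : ℕ} (hT : IsAnalyticOnTorus M (D.T j))
    (hS : IsAnalyticOnTorus M (D.S j)) (κ : ℝ) (x : Angle l × Slow m) (k : Fin l → ℤ) :
    D.step j κ (x + latticeShift k) = D.step j κ x + latticeShift k := by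
  simp only [step_eq, generator_add_latticeShift hT hS]
  abel

theorem analyticAt_remainder {j : ℕ} (hF : IsAnalyticFamily M (D.F j))
    (hG : IsAnalyticFamily M (D.G j)) {x : Angle l × Slow m} (hx : x ∈ (univ : Set (Angle l)) ×ˢ M) :
    AnalyticAt ℝ (D.remainder j) (x, 0) := by
  have h1 : AnalyticAt ℝ (fun p : (Angle l × Slow m) × ℝ => (p.1.1, p.1.2, p.2)) (x, 0) :=
    (analyticAt_fst.comp analyticAt_fst).prod
      ((analyticAt_snd.comp analyticAt_fst).prod analyticAt_snd)
  have h2 : (x.1, x.2, (0 : ℝ)) ∈ (univ : Set (Angle l)) ×ˢ M ×ˢ ({0} : Set ℝ) :=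
    ⟨mem_univ _, hx.2, rfl⟩
  exact ((hF.2 _ h2).fun_comp (x := (x, (0 : ℝ))) h1).prod ((hG.2 _ h2).fun_comp (x := (x, (0 : ℝ))) h1)

theorem analyticOnNhd_averaged {j : ℕ} (hF : IsAnalyticFamily M (D.F j))
    (hG : IsAnalyticFamily M (D.G j)) :
    AnalyticOnNhd ℝ (D.averaged j) (univ ×ˢ M) := fun _ hx =>
  ((hF.analyticOnNhd_angleAverage _ hx.2).comp analyticAt_snd).prod
    ((hG.analyticOnNhd_angleAverage _ hx.2).comp analyticAt_snd)

theorem analyticOnNhd_generator {j : ℕ} (hT : IsAnalyticOnTorus M (D.T j))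
    (hS : IsAnalyticOnTorus M (D.S j)) : AnalyticOnNhd ℝ (D.generator j) (univ ×ˢ M) :=
  hT.2.prod hS.2

theorem analyticAt_averagedSum {j : ℕ} (hF : ∀ i ∈ Finset.Ico 1 j, IsAnalyticFamily M (D.F i))
    (hG : ∀ i ∈ Finset.Ico 1 j, IsAnalyticFamily M (D.G i)) {x : Angle l × Slow m}
    (hx : x ∈ (univ : Set (Angle l)) ×ˢ M) : AnalyticAt ℝ (D.averagedSum j) (x, 0) :=
  Finset.analyticAt_fun_sum _ fun i hi => (analyticAt_snd.pow (i - 1)).smul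
    ((analyticOnNhd_averaged (hF i hi) (hG i hi) x hx).comp (g := D.averaged i) analyticAt_fst)

theorem analyticAt_step {j : ℕ} (hT : IsAnalyticOnTorus M (D.T j))
    (hS : IsAnalyticOnTorus M (D.S j)) {x : Angle l × Slow m} (hx : x ∈ (univ : Set (Angle l)) ×ˢ M) :
    AnalyticAt ℝ (fun p : (Angle l × Slow m) × ℝ => D.step j p.2 p.1) (x, 0) :=
  analyticAt_fst.add ((analyticAt_snd.pow j).smul
    ((analyticOnNhd_generator hT hS x hx).comp (g := D.generator j) analyticAt_fst))

theorem analyticAt_normalForm {j : ℕ} (hF : ∀ i ∈ Finset.Icc 1 j, IsAnalyticFamily M (D.F i))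
    (hG : ∀ i ∈ Finset.Icc 1 j, IsAnalyticFamily M (D.G i)) (hj : 1 ≤ j) {x : Angle l × Slow m}
    (hx : x ∈ (univ : Set (Angle l)) ×ˢ M) :
    AnalyticAt ℝ (fun p : (Angle l × Slow m) × ℝ => D.normalForm ω₀ j p.2 p.1) (x, 0) := by
  simp only [normalForm_eq]
  have hj' : j ∈ Finset.Icc 1 j := Finset.mem_Icc.2 ⟨hj, le_rfl⟩
  exact ((analyticAt_fst.add analyticAt_const).add (analyticAt_snd.smul (analyticAt_averagedSum
    (fun i hi => hF i (Finset.Ico_subset_Icc_self hi))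
    (fun i hi => hG i (Finset.Ico_subset_Icc_self hi)) hx))).add
    ((analyticAt_snd.pow j).smul (analyticAt_remainder (hF j hj') (hG j hj') hx))

theorem step_zero {j : ℕ} (hj : j ≠ 0) (x : Angle l × Slow m) : D.step j 0 x = x := by
  simp [step_eq, hj]

theorem normalForm_zero {j : ℕ} (hj : j ≠ 0) (x : Angle l × Slow m) :
    D.normalForm ω₀ j 0 x = x + (ω₀, 0) := by
  simp [normalForm_eq, hj]

variable {F : Angle l → Slow m → ℝ → Angle l} {G : Angle l → Slow m → ℝ → Slow m} {n : ℕ}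

/-- Both components of the generator solve cohomological equations for the current remainder at κ =
0. Only the remainders of index n+2 and the generators of index n+1 are overwritten, so the earlier
conjugacies persist. -/
theorem IsDecoupling.exists_succ (hω₀ : IsDiophantine ω₀) (hM : IsOpen M)
    (hD : D.IsDecoupling ω₀ M F G n) :
    ∃ D' : DecouplingData l m, D'.IsDecoupling ω₀ M F G (n + 1) := by
  have hmem : n + 1 ∈ Finset.Icc 1 (n + 1) := Finset.mem_Icc.2 ⟨by omega, le_rfl⟩
  have hFa := hD.analytic_F (n + 1) hmem
  have hGa := hD.analytic_G (n + 1) hmem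
  obtain ⟨T, hT, hTc⟩ := hω₀.exists_cohomological_solution hFa.isAnalyticOnTorus
  obtain ⟨S, hS, hSc⟩ := hω₀.exists_cohomological_solution hGa.isAnalyticOnTorus
  set τ : Angle l × Slow m → Angle l × Slow m := fun x => (T x.1 x.2, S x.1 x.2) with hτ
  obtain ⟨R, hRper, hRa, hRc⟩ := exists_conjugacy_remainder (N := univ ×ˢ M) (Ω := (ω₀, 0))
    (j := n + 1) (B := D.averagedSum (n + 1)) (A := D.remainder (n + 1))
    (Abar := D.averaged (n + 1)) (τ := τ)
    (isOpen_univ.prod hM) (fun _ hx => ⟨mem_univ _, by simpa using hx.2⟩) (by omega)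
    (fun x hx => analyticAt_averagedSum
      (fun i hi => hD.analytic_F i (Finset.Ico_subset_Icc_self hi))
      (fun i hi => hD.analytic_G i (Finset.Ico_subset_Icc_self hi)) hx)
    (fun x hx => analyticAt_remainder hFa hGa hx) (analyticOnNhd_averaged hFa hGa)
    (fun x hx => (hT.2 x hx).prod (hS.2 x hx)) (fun x hx => by
      have h1 := hTc x.2 hx.2 x.1
      have h2 := hSc x.2 hx.2 x.1
      refine Prod.ext ?_ ?_
      · simp only [remainder, averaged, hτ, angleAverage, Prod.fst_add, Prod.fst_sub,
          Prod.snd_add, add_zero]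
        rw [add_sub_assoc, h1]; abel
      · simp only [remainder, averaged, hτ, angleAverage, Prod.fst_add, Prod.snd_sub,
          Prod.snd_add, add_zero]
        rw [add_sub_assoc, h2]; abel)
  have hRp : ∀ x κ (k : Fin l → ℤ), R (x + latticeShift k, κ) = R (x, κ) := by
    intro x κ k
    refine hRper _ (fun x κ => averagedSum_add_latticeShift _ _ _ _)
      (fun x κ => remainder_add_latticeShift hFa hGa _ _ _)
      (fun x => averaged_add_latticeShift _ _ _) (fun x => ?_) x κ
    have h1 := hT.1 x.2 x.1 k
    have h2 := hS.1 x.2 x.1 k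
    simp only at h1 h2
    simp only [hτ, latticeShift, Prod.fst_add, Prod.snd_add, add_zero, h1, h2]
  have hRp' : ∀ θ J κ (k : Fin l → ℤ), R ((θ + fun i => (k i : ℝ), J), κ) = R ((θ, J), κ) := by
    intro θ J κ k
    simpa [latticeShift] using hRp (θ, J) κ k
  have hRa' : AnalyticOnNhd ℝ (fun p : Angle l × Slow m × ℝ => R ((p.1, p.2.1), p.2.2))
      (univ ×ˢ M ×ˢ ({0} : Set ℝ)) := by
    rintro ⟨θ, J, κ⟩ ⟨-, hJ, rfl⟩
    exact (hRa (θ, J) ⟨mem_univ _, hJ⟩).fun_comp (x := (θ, J, (0 : ℝ)))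
      (f := fun p : Angle l × Slow m × ℝ => ((p.1, p.2.1), p.2.2))
      ((analyticAt_fst.prod (analyticAt_fst.comp analyticAt_snd)).prod
        (analyticAt_snd.comp analyticAt_snd))
  let D' : DecouplingData l m :=
    { F := Function.update D.F (n + 2) fun θ J κ => (R ((θ, J), κ)).1
      G := Function.update D.G (n + 2) fun θ J κ => (R ((θ, J), κ)).2
      T := Function.update D.T (n + 1) T
      S := Function.update D.S (n + 1) S }
  have hF' : ∀ i ≠ n + 2, D'.F i = D.F i := fun i hi => Function.update_of_ne hi _ _
  have hG' : ∀ i ≠ n + 2, D'.G i = D.G i := fun i hi => Function.update_of_ne hi _ _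
  have hT' : ∀ i ≠ n + 1, D'.T i = D.T i := fun i hi => Function.update_of_ne hi _ _
  have hS' : ∀ i ≠ n + 1, D'.S i = D.S i := fun i hi => Function.update_of_ne hi _ _
  have hF2 : D'.F (n + 2) = fun θ J κ => (R ((θ, J), κ)).1 := Function.update_self _ _ _
  have hG2 : D'.G (n + 2) = fun θ J κ => (R ((θ, J), κ)).2 := Function.update_self _ _ _
  have hT1 : D'.T (n + 1) = T := Function.update_self _ _ _
  have hS1 : D'.S (n + 1) = S := Function.update_self _ _ _
  have hNF : ∀ j ≤ n + 1, D'.normalForm ω₀ j = D.normalForm ω₀ j := fun j hj =>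
    normalForm_congr (fun i hi => hF' i (by omega)) (fun i hi => hG' i (by omega))
  have hFa2 : IsAnalyticFamily M (D'.F (n + 2)) := by
    rw [hF2]
    exact ⟨fun J κ θ k => congrArg Prod.fst (hRp' θ J κ k),
      fun p hp => analyticAt_fst.comp (hRa' p hp)⟩
  have hGa2 : IsAnalyticFamily M (D'.G (n + 2)) := by
    rw [hG2]
    exact ⟨fun J κ θ k => congrArg Prod.snd (hRp' θ J κ k),
      fun p hp => analyticAt_snd.comp (hRa' p hp)⟩
  refine ⟨D', ⟨?_, ?_, ?_, ?_, ?_, ?_, ?_⟩⟩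
  · rw [hF' 1 (by omega), hD.F_one]
  · rw [hG' 1 (by omega), hD.G_one]
  · intro j hj
    rw [Finset.mem_Icc] at hj
    rcases eq_or_ne j (n + 2) with rfl | h
    · exact hFa2
    · rw [hF' j h]; exact hD.analytic_F j (Finset.mem_Icc.2 (by omega))
  · intro j hj
    rw [Finset.mem_Icc] at hj
    rcases eq_or_ne j (n + 2) with rfl | h
    · exact hGa2
    · rw [hG' j h]; exact hD.analytic_G j (Finset.mem_Icc.2 (by omega))
  · intro j hj
    rw [Finset.mem_Icc] at hj
    rcases eq_or_ne j (n + 1) with rfl | h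
    · rw [hT1]; exact hT
    · rw [hT' j h]; exact hD.analytic_T j (Finset.mem_Icc.2 (by omega))
  · intro j hj
    rw [Finset.mem_Icc] at hj
    rcases eq_or_ne j (n + 1) with rfl | h
    · rw [hS1]; exact hS
    · rw [hS' j h]; exact hD.analytic_S j (Finset.mem_Icc.2 (by omega))
  · intro j hj K hK hKM
    rw [Finset.mem_Icc] at hj
    rcases eq_or_ne j (n + 1) with rfl | h
    · have hstep : ∀ κ x, D'.step (n + 1) κ x = x + κ ^ (n + 1) • τ x := by
        intro κ x
        rw [step_eq, generator, hT1, hS1]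
      have hnf : ∀ κ x, D'.normalForm ω₀ (n + 1 + 1) κ x = x + (ω₀, 0) +
          κ • D.averagedSum (n + 1) (x, κ) + κ ^ (n + 1) • D.averaged (n + 1) x
          + κ ^ (n + 1 + 1) • R (x, κ) := by
        intro κ x
        rw [normalForm_eq, averagedSum_succ (by omega), smul_averagedSum, smul_averagedSum,
          remainder, hF2, hG2, ← add_assoc]
        have h1 : ∀ i ≤ n + 1, D'.averaged i x = D.averaged i x := fun i hi => by
          rw [averaged, averaged, hF' i (by omega), hG' i (by omega)]
        rw [h1 _ le_rfl, Finset.sum_congr rfl fun i hi => by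
          rw [h1 i (Finset.mem_Ico.1 hi).2.le]]
      have hev : ∀ᶠ κ in 𝓝 (0 : ℝ), ∀ x ∈ (univ : Set (Angle l)) ×ˢ K,
          D'.normalForm ω₀ (n + 1) κ (D'.step (n + 1) κ x)
            = D'.step (n + 1) κ (D'.normalForm ω₀ (n + 1 + 1) κ x) := by
        -- Both sides of the conjugacy commute with lattice translations, so local validity on a
        -- compact cube is enough.
        refine eventually_forall_torus hK (fun x κ k h => ?_) fun x hx => ?_
        · have hT1' : IsAnalyticOnTorus M (D'.T (n + 1)) := by rw [hT1]; exact hT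
          have hS1' : IsAnalyticOnTorus M (D'.S (n + 1)) := by rw [hS1]; exact hS
          rw [hNF _ le_rfl] at h ⊢
          rw [step_add_latticeShift hT1' hS1', normalForm_add_latticeShift hFa hGa,
            normalForm_add_latticeShift hFa2 hGa2, step_add_latticeShift hT1' hS1'] at h
          exact add_right_cancel h
        · filter_upwards [hRc x ⟨hx.1, hKM hx.2⟩] with p hp
          rw [hNF _ le_rfl, normalForm_eq, hstep p.2 (D'.normalForm _ _ _ _)]
          exact hp _ _ (hstep _ _) (hnf _ _)
      obtain ⟨κ₀, hκ₀, hball⟩ := Metric.eventually_nhds_iff.1 hev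
      exact ⟨κ₀, hκ₀, fun κ hκ ψ I hI => hball (by simpa using hκ) (ψ, I) ⟨mem_univ _, hI⟩⟩
    · obtain ⟨κ₀, hκ₀, hc⟩ := hD.conj j (Finset.mem_Icc.2 (by omega)) K hK hKM
      refine ⟨κ₀, hκ₀, fun κ hκ ψ I hI => ?_⟩
      have hst : D'.step j = D.step j := by
        ext1 κ; ext1 x
        rw [step_eq, step_eq, generator, generator, hT' j h, hS' j h]
      rw [hst, hNF j (by omega), hNF (j + 1) (by omega)]
      exact hc κ hκ ψ I hI

theorem exists_isDecoupling (hω₀ : IsDiophantine ω₀) (hM : IsOpen M)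
    (hF : IsAnalyticFamily M F) (hG : IsAnalyticFamily M G) (n : ℕ) :
    ∃ D : DecouplingData l m, D.IsDecoupling ω₀ M F G n := by
  induction n with
  | zero =>
    refine ⟨⟨fun _ => F, fun _ => G, fun _ _ _ => 0, fun _ _ _ => 0⟩, rfl, rfl, fun _ _ => hF,
      fun _ _ => hG, ?_, ?_, ?_⟩ <;> simp
  | succ n ih =>
    obtain ⟨D, hD⟩ := ih
    exact hD.exists_succ hω₀ hM

end DecouplingData

end SlowFast

namespace SlowFast

/-! ### Maps close to the identity, uniformly over the torus. -/

section NearIdentity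

open scoped ContDiff

variable {X : Type*} [NormedAddCommGroup X] [NormedSpace ℝ X] [CompleteSpace X]

/-- An analytic map whose distance to the identity is `1/2`-Lipschitz on an open set is an analytic
diffeomorphism onto an open set. -/
theorem analytic_diffeomorphism_of_near_identity {N : Set X} (hN : IsOpen N) {φ : X → X}
    (hφ : AnalyticOnNhd ℝ φ N)
    (hlip : ∀ x ∈ N, ∀ y ∈ N, ‖(φ x - x) - (φ y - y)‖ ≤ 1 / 2 * ‖x - y‖) :
    InjOn φ N ∧ IsOpen (φ '' N) ∧ AnalyticOnNhd ℝ (Function.invFunOn φ N) (φ '' N) := by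
  have hinj : InjOn φ N := by
    intro x hx y hy hxy
    have h := hlip x hx y hy
    rw [hxy, sub_sub_sub_cancel_left, norm_sub_rev] at h
    exact sub_eq_zero.1 (norm_eq_zero.1 (by linarith [norm_nonneg (x - y)]))
  have hloc : ∀ x ∈ N, ∃ g : X → X, AnalyticAt ℝ g (φ x) ∧
      ∀ᶠ z in 𝓝 (φ x), φ (g z) = z ∧ g z ∈ N := by
    intro x hx
    have hd := (hφ x hx).differentiableAt.hasFDerivAt
    have hL : LipschitzOnWith (1 / 2) (fun y => φ y - y) N := by
      refine LipschitzOnWith.of_dist_le_mul fun y hy z hz => ?_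
      simpa [dist_eq_norm] using hlip y hy z hz
    have hn : ‖fderiv ℝ φ x - .id ℝ X‖ ≤ 1 / 2 := by
      simpa using (hd.sub (hasFDerivAt_id x)).le_of_lipschitzOn (hN.mem_nhds hx) hL
    have hn' : ‖ContinuousLinearMap.id ℝ X - fderiv ℝ φ x‖ < 1 := by
      rw [norm_sub_rev]; linarith
    -- The derivative is within 1/2 of the identity, hence invertible by the Neumann series.
    set e : X ≃L[ℝ] X := ContinuousLinearEquiv.unitsEquiv ℝ X (Units.oneSub _ hn') with he
    have he' : (e : X →L[ℝ] X) = fderiv ℝ φ x := by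
      ext v
      simp [he, Units.oneSub]
    rw [← he'] at hd
    have hcd : ContDiffAt ℝ ω φ x := (hφ x hx).contDiffAt
    have hs := hcd.hasStrictFDerivAt' hd (by simp)
    refine ⟨hcd.localInverse hd (by simp), (hcd.to_localInverse hd (by simp)).analyticAt, ?_⟩
    refine hs.eventually_right_inverse.and ?_
    have hc := hs.localInverse_continuousAt
    refine hc.eventually ?_
    rw [hs.localInverse_apply_image]
    exact hN.mem_nhds hx
  refine ⟨hinj, ?_, ?_⟩
  · rw [isOpen_iff_mem_nhds]
    rintro _ ⟨x, hx, rfl⟩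
    obtain ⟨g, -, hg⟩ := hloc x hx
    exact hg.mono fun z hz => ⟨g z, hz.2, hz.1⟩
  · rintro _ ⟨x, hx, rfl⟩
    obtain ⟨g, hga, hg⟩ := hloc x hx
    refine hga.congr (hg.mono fun z hz => ?_)
    conv_rhs => rw [← hz.1]
    exact (hinj.leftInvOn_invFunOn hz.2).symm

omit [CompleteSpace X] in
/-- A family of maps through the identity is locally close to the identity in the Lipschitz
sense. -/
theorem eventually_lipschitz_near_identity {H : X × ℝ → X} (hH0 : ∀ x, H (x, 0) = x) {x : X}
    (hH : AnalyticAt ℝ H (x, 0)) :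
    ∀ᶠ q in 𝓝 ((x, (0 : ℝ)), x),
      ‖(H q.1 - q.1.1) - (H (q.2, q.1.2) - q.2)‖ ≤ 1 / 2 * ‖q.1.1 - q.2‖ := by
  set g : X × ℝ → X := fun p => H p - p.1 with hg
  have hga : AnalyticAt ℝ g (x, 0) := hH.sub analyticAt_fst
  have hs := hga.hasStrictFDerivAt
  have hL : ∀ v : X, fderiv ℝ g (x, 0) (v, 0) = 0 := by
    intro v
    have h1 : HasFDerivAt (fun y : X => g (y, 0)) (fderiv ℝ g (x, 0) ∘L .inl ℝ X ℝ) x :=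
      HasFDerivAt.comp (f := fun y : X => (y, (0 : ℝ))) x hga.differentiableAt.hasFDerivAt
        (hasFDerivAt_prodMk_left x (0 : ℝ))
    have h2 : (fun y : X => g (y, 0)) = fun _ => 0 := by ext y; simp [hg, hH0]
    rw [h2] at h1
    have h3 := h1.unique (hasFDerivAt_const 0 x)
    simpa using congrArg (fun A => A v) h3
  have h := hs.isLittleO.bound (show (0 : ℝ) < 1 / 2 by norm_num)
  have ht : Tendsto (fun q : (X × ℝ) × X => (q.1, (q.2, q.1.2))) (𝓝 ((x, (0 : ℝ)), x))
      (𝓝 ((x, 0), (x, 0))) :=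
    (show Continuous fun q : (X × ℝ) × X => (q.1, (q.2, q.1.2)) by fun_prop).tendsto _
  filter_upwards [ht.eventually h] with q hq
  have h4 : q.1 - (q.2, q.1.2) = (q.1.1 - q.2, 0) := by ext <;> simp
  rw [h4, hL, sub_zero] at hq
  simpa [Prod.norm_def] using hq

end NearIdentity

variable {l m : ℕ}

theorem eventually_bound_torus {E : Type*} [NormedAddCommGroup E]
    {f : (Angle l × Slow m) × ℝ → E} {C : Set (Slow m)} (hC : IsCompact C)
    (hper : ∀ x κ k, f (x + latticeShift k, κ) = f (x, κ))
    (hf : ∀ x ∈ (univ : Set (Angle l)) ×ˢ C, ContinuousAt f (x, 0)) :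
    ∃ B : ℝ, ∀ᶠ κ in 𝓝 (0 : ℝ), ∀ x ∈ (univ : Set (Angle l)) ×ˢ C, ‖f (x, κ)‖ ≤ B := by
  have hQ : IsCompact (Icc (0 : Angle l) 1 ×ˢ C) := isCompact_Icc.prod hC
  obtain ⟨B, hB⟩ := hQ.exists_bound_of_continuousOn (f := fun x => f (x, 0)) fun x hx =>
    ((hf x ⟨mem_univ _, hx.2⟩).comp (f := fun x => (x, (0 : ℝ))) (by fun_prop)).continuousWithinAt
  refine ⟨B + 1, eventually_forall_torus_of_cube hC (fun x κ k h => by rwa [hper] at h) fun x hx => ?_⟩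
  have h1 : ‖f (x, 0)‖ < B + 1 := by linarith [hB x hx]
  exact ((hf x ⟨mem_univ _, hx.2⟩).norm.tendsto.eventually_lt_const h1).mono fun p hp => hp.le

/-- Uniform first-order estimate in `κ`. -/
theorem eventually_bound_sub_torus {E : Type*} [NormedAddCommGroup E] [NormedSpace ℝ E]
    [CompleteSpace E] {f : (Angle l × Slow m) × ℝ → E} {C : Set (Slow m)} (hC : IsCompact C)
    (hper : ∀ x κ k, f (x + latticeShift k, κ) = f (x, κ))
    (hf : ∀ x ∈ (univ : Set (Angle l)) ×ˢ C, AnalyticAt ℝ f (x, 0)) :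
    ∃ B : ℝ, ∀ᶠ κ in 𝓝 (0 : ℝ), ∀ x ∈ (univ : Set (Angle l)) ×ˢ C,
      ‖f (x, κ) - f (x, 0)‖ ≤ B * |κ| := by
  obtain ⟨B, hB⟩ := eventually_bound_torus hC
    (f := fun p => dslope (fun s => f (p.1, s)) 0 p.2)
    (fun x κ k => by simp only [hper]) fun x hx => (analyticAt_dslope (hf x hx)).continuousAt
  refine ⟨B, hB.mono fun κ hκ x hx => ?_⟩
  have h := sub_smul_dslope (fun s => f (x, s)) 0 κ
  simp only [sub_zero] at h
  rw [← h, norm_smul, Real.norm_eq_abs, mul_comm]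
  exact mul_le_mul_of_nonneg_right (hκ x hx) (abs_nonneg _)

/-- A lattice-equivariant analytic family of maps through the identity is uniformly close to the
identity in the Lipschitz sense on (torus) × `C`. -/
theorem eventually_lipschitz_torus {H : (Angle l × Slow m) × ℝ → Angle l × Slow m}
    {C : Set (Slow m)} (hC : IsCompact C) (hH0 : ∀ x, H (x, 0) = x)
    (hper : ∀ x κ k, H (x + latticeShift k, κ) = H (x, κ) + latticeShift k)
    (hH : ∀ x ∈ (univ : Set (Angle l)) ×ˢ C, AnalyticAt ℝ H (x, 0)) :
    ∀ᶠ κ in 𝓝 (0 : ℝ), ∀ x ∈ (univ : Set (Angle l)) ×ˢ C, ∀ y ∈ (univ : Set (Angle l)) ×ˢ C,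
      ‖(H (x, κ) - x) - (H (y, κ) - y)‖ ≤ 1 / 2 * ‖x - y‖ := by
  -- For points at distance more than 1, displacements of size 1/4 already give the bound: 1/4 + 1/4
  -- ≤ ‖x − y‖/2.
  have hclose : ∀ᶠ κ in 𝓝 (0 : ℝ), ∀ x ∈ (univ : Set (Angle l)) ×ˢ C, ‖H (x, κ) - x‖ ≤ 1 / 4 := by
    refine eventually_forall_torus hC (fun x κ k h => ?_) fun x hx => ?_
    · rwa [hper, add_sub_add_right_eq_sub] at h
    · have h1 : ContinuousAt (fun p : (Angle l × Slow m) × ℝ => ‖H p - p.1‖) (x, 0) :=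
        ((hH x hx).continuousAt.sub continuousAt_fst).norm
      have h2 : ‖H (x, 0) - x‖ < 1 / 4 := by rw [hH0, sub_self, norm_zero]; norm_num
      exact (h1.tendsto.eventually_lt_const h2).mono fun p hp => hp.le
  -- The second point is encoded by its angular offset from x, so that simultaneous lattice shifts
  -- of the pair leave the parameter `z` in a compact set.
  have hnear : ∀ᶠ κ in 𝓝 (0 : ℝ), ∀ x ∈ (univ : Set (Angle l)) ×ˢ C,
      ∀ z ∈ Metric.closedBall (0 : Angle l) 1 ×ˢ C,
      ‖(H (x, κ) - x) - (H ((x.1 + z.1, z.2), κ) - (x.1 + z.1, z.2))‖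
        ≤ 1 / 2 * ‖x - (x.1 + z.1, z.2)‖ := by
    refine eventually_forall_torus hC (fun x κ k h z hz => ?_) fun x hx => ?_
    · have h1 := h z hz
      have h2 : ((x + latticeShift k).1 + z.1, z.2) = (x.1 + z.1, z.2) + latticeShift k := by
        ext <;> simp [latticeShift, add_right_comm]
      rw [h2, hper, hper] at h1
      simpa only [add_sub_add_right_eq_sub] using h1
    · have hK : IsCompact (Metric.closedBall (0 : Angle l) 1 ×ˢ C) :=
        (isCompact_closedBall _ _).prod hC
      refine hK.eventually_forall_of_forall_eventually (x₀ := (x, (0 : ℝ)))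
        (P := fun p z => ‖(H p - p.1) - (H ((p.1.1 + z.1, z.2), p.2) - (p.1.1 + z.1, z.2))‖
        ≤ 1 / 2 * ‖p.1 - (p.1.1 + z.1, z.2)‖) fun z hz => ?_
      have hcont : Continuous fun q : ((Angle l × Slow m) × ℝ) × (Angle l × Slow m) =>
          (q.1.1.1 + q.2.1, q.2.2) := by fun_prop
      -- On the diagonal strict differentiability at κ = 0 is needed. Off the diagonal the
      -- inequality is strict at κ = 0 and persists by continuity.
      by_cases hxz : x = (x.1 + z.1, z.2)
      · have ht : Tendsto (fun q : ((Angle l × Slow m) × ℝ) × (Angle l × Slow m) =>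
            (q.1, (q.1.1.1 + q.2.1, q.2.2))) (𝓝 ((x, 0), z)) (𝓝 ((x, 0), x)) := by
          have := (continuous_fst.prodMk hcont).tendsto ((x, (0 : ℝ)), z)
          simpa only [← hxz] using this
        exact ht.eventually (eventually_lipschitz_near_identity hH0 (hH x hx))
      · have hz' : (x.1 + z.1, z.2) ∈ (univ : Set (Angle l)) ×ˢ C := ⟨mem_univ _, hz.2⟩
        have h1 : ContinuousAt (fun q : ((Angle l × Slow m) × ℝ) × (Angle l × Slow m) =>
            H ((q.1.1.1 + q.2.1, q.2.2), q.1.2)) ((x, 0), z) :=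
          ContinuousAt.comp (f := fun q : ((Angle l × Slow m) × ℝ) × (Angle l × Slow m) =>
            ((q.1.1.1 + q.2.1, q.2.2), q.1.2)) (hH _ hz').continuousAt (by fun_prop)
        have h2 : ContinuousAt (fun q : ((Angle l × Slow m) × ℝ) × (Angle l × Slow m) =>
            H q.1) ((x, 0), z) :=
          ContinuousAt.comp (f := fun q : ((Angle l × Slow m) × ℝ) × (Angle l × Slow m) => q.1)
            (hH x hx).continuousAt continuousAt_fst
        have h3 : ContinuousAt (fun q : ((Angle l × Slow m) × ℝ) × (Angle l × Slow m) =>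
            ‖(H q.1 - q.1.1) - (H ((q.1.1.1 + q.2.1, q.2.2), q.1.2) - (q.1.1.1 + q.2.1, q.2.2))‖)
            ((x, 0), z) :=
          ((h2.sub (by fun_prop)).sub (h1.sub hcont.continuousAt)).norm
        have h4 : ContinuousAt (fun q : ((Angle l × Slow m) × ℝ) × (Angle l × Slow m) =>
            1 / 2 * ‖q.1.1 - (q.1.1.1 + q.2.1, q.2.2)‖) ((x, 0), z) := by fun_prop
        refine (h3.tendsto.eventually_lt h4.tendsto ?_).mono fun q hq => hq.le
        simp only [hH0, sub_self, norm_zero]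
        exact mul_pos (by norm_num) (norm_pos_iff.2 (sub_ne_zero.2 hxz))
  filter_upwards [hclose, hnear] with κ h1 h2 x hx y hy
  by_cases hxy : ‖x - y‖ ≤ 1
  · have h3 := h2 x hx (y.1 - x.1, y.2) ⟨?_, hy.2⟩
    · simpa using h3
    · rw [mem_closedBall_zero_iff, norm_sub_rev]
      exact (norm_fst_le (x - y)).trans hxy
  · have h3 := norm_sub_le (H (x, κ) - x) (H (y, κ) - y)
    have h4 := h1 x hx
    have h5 := h1 y hy
    rw [not_le] at hxy
    linarith

end SlowFast

/-! ### The composed transformation, and the corrected one-step error. -/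

namespace SlowFast

variable {l m : ℕ}

theorem exists_lipschitz_of_analyticOnNhd {X E : Type*} [NormedAddCommGroup X] [NormedSpace ℝ X]
    [NormedAddCommGroup E] [NormedSpace ℝ E] [CompleteSpace E] {g : X → E} {C : Set X}
    (hC : IsCompact C) (hg : AnalyticOnNhd ℝ g C) :
    ∃ L : ℝ, 0 ≤ L ∧ ∀ x ∈ C, ∀ y ∈ C, ‖g x - g y‖ ≤ L * ‖x - y‖ := by
  have hloc : LocallyLipschitzOn C g := fun x hx => by
    obtain ⟨K, t, ht, h⟩ := ((hg x hx).contDiffAt (n := 1)).exists_lipschitzOnWith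
    exact ⟨K, t, mem_nhdsWithin_of_mem_nhds ht, h⟩
  obtain ⟨K, hK⟩ := hloc.exists_lipschitzOnWith_of_compact hC
  exact ⟨K, K.2, fun x hx y hy => by simpa [dist_eq_norm] using hK.dist_le_mul x hx y hy⟩

/-- Discrete Gronwall estimate over times of order `1 / κ`. -/
theorem gronwall_growth {Λ a c κ T : ℝ} (hΛ : 0 ≤ Λ) (hκ : 0 < κ) (ha : 0 ≤ a) (hc : 0 ≤ c) {t : ℕ}
    (ht : (t : ℝ) < T / κ) :
    (1 + κ * Λ) ^ t * (a + t * (κ * c)) ≤ Real.exp (Λ * T) * (a + T * c) := by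
  have h1 : t * κ ≤ T := ((lt_div_iff₀ hκ).1 ht).le
  have h2 : (1 + κ * Λ) ^ t ≤ Real.exp (Λ * T) := by
    calc (1 + κ * Λ) ^ t ≤ Real.exp (κ * Λ) ^ t := by
          gcongr; linarith [Real.add_one_le_exp (κ * Λ)]
      _ = Real.exp (Λ * (t * κ)) := by rw [← Real.exp_nat_mul]; congr 1; ring
      _ ≤ _ := Real.exp_le_exp.2 (mul_le_mul_of_nonneg_left h1 hΛ)
  have h3 : t * (κ * c) ≤ T * c := by
    rw [← mul_assoc]; exact mul_le_mul_of_nonneg_right h1 hc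
  gcongr

namespace DecouplingData

variable {D : DecouplingData l m} {ω₀ : Angle l} {M : Set (Slow m)}
  {F : Angle l → Slow m → ℝ → Angle l} {G : Angle l → Slow m → ℝ → Slow m} {n : ℕ}

theorem hInv_zero (j : ℕ) (x : Angle l × Slow m) : D.hInv j 0 x = x := by
  induction j with
  | zero => rfl
  | succ j ih => rw [hInv, Function.comp_apply, step_zero (by omega), ih]

namespace IsDecoupling

theorem slowFastMap_eq (hD : D.IsDecoupling ω₀ M F G n) (κ : ℝ) :
    slowFastMap ω₀ F G κ = D.normalForm ω₀ 1 κ := by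
  ext1 x
  simp [slowFastMap, normalForm, hD.F_one, hD.G_one]

theorem analyticAt_hInv (hD : D.IsDecoupling ω₀ M F G n) {j : ℕ} (hj : j ≤ n)
    {x : Angle l × Slow m} (hx : x ∈ (univ : Set (Angle l)) ×ˢ M) :
    AnalyticAt ℝ (fun p : (Angle l × Slow m) × ℝ => D.hInv j p.2 p.1) (x, 0) := by
  induction j with
  | zero => exact analyticAt_fst
  | succ j ih =>
    have hm : j + 1 ∈ Finset.Icc 1 n := Finset.mem_Icc.2 ⟨by omega, hj⟩
    have h1 := analyticAt_step (hD.analytic_T _ hm) (hD.analytic_S _ hm) hx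
    refine AnalyticAt.fun_comp (g := fun p : (Angle l × Slow m) × ℝ => D.hInv j p.2 p.1)
      (f := fun p : (Angle l × Slow m) × ℝ => (D.step (j + 1) p.2 p.1, p.2)) ?_
      (h1.prod analyticAt_snd)
    rw [step_zero (by omega)]
    exact ih (by omega)

theorem hInv_add_latticeShift (hD : D.IsDecoupling ω₀ M F G n) {j : ℕ} (hj : j ≤ n) (κ : ℝ)
    (x : Angle l × Slow m) (k : Fin l → ℤ) :
    D.hInv j κ (x + latticeShift k) = D.hInv j κ x + latticeShift k := by
  induction j generalizing x with
  | zero => rfl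
  | succ j ih =>
    have hm : j + 1 ∈ Finset.Icc 1 n := Finset.mem_Icc.2 ⟨by omega, hj⟩
    simp only [hInv, Function.comp_apply,
      step_add_latticeShift (hD.analytic_T _ hm) (hD.analytic_S _ hm), ih (by omega)]

/-- The threshold of `conj` depends on a compact set; a closed ball of slow variables around the
base point turns it into a joint neighbourhood in (x, κ). -/
theorem eventually_conj (hD : D.IsDecoupling ω₀ M F G n) (hM : IsOpen M) {j : ℕ}
    (hj : j ∈ Finset.Icc 1 n) {x : Angle l × Slow m} (hx : x ∈ (univ : Set (Angle l)) ×ˢ M) :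
    ∀ᶠ p in 𝓝 (x, (0 : ℝ)), D.normalForm ω₀ j p.2 (D.step j p.2 p.1)
      = D.step j p.2 (D.normalForm ω₀ (j + 1) p.2 p.1) := by
  obtain ⟨r, hr, hrM⟩ := Metric.nhds_basis_closedBall.mem_iff.1 (hM.mem_nhds hx.2)
  obtain ⟨κ₀, hκ₀, h⟩ := hD.conj j hj _ (isCompact_closedBall x.2 r) hrM
  have h1 : ∀ᶠ p : (Angle l × Slow m) × ℝ in 𝓝 (x, (0 : ℝ)), p.1.2 ∈ Metric.closedBall x.2 r :=
    (show Continuous fun p : (Angle l × Slow m) × ℝ => p.1.2 by fun_prop).continuousAt.eventually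
      (Metric.closedBall_mem_nhds _ hr)
  have h2 : ∀ᶠ p : (Angle l × Slow m) × ℝ in 𝓝 (x, (0 : ℝ)), |p.2| < κ₀ :=
    (show Continuous fun p : (Angle l × Slow m) × ℝ => |p.2| by fun_prop).continuousAt.tendsto.eventually_lt_const
      (by simpa using hκ₀)
  filter_upwards [h1, h2] with p hp1 hp2
  exact h p.2 hp2 p.1.1 p.1.2 hp1

/-- Conjugacies telescope: the map decoupled below order j+1 is passed through `step (j + 1)`. The
local form matters because `step` moves the base point, but not at κ = 0. -/
theorem eventually_conj_hInv (hD : D.IsDecoupling ω₀ M F G n) (hM : IsOpen M) {j : ℕ}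
    (hj : j ≤ n) {x : Angle l × Slow m} (hx : x ∈ (univ : Set (Angle l)) ×ˢ M) :
    ∀ᶠ p in 𝓝 (x, (0 : ℝ)), D.normalForm ω₀ 1 p.2 (D.hInv j p.2 p.1)
      = D.hInv j p.2 (D.normalForm ω₀ (j + 1) p.2 p.1) := by
  induction j with
  | zero => exact Eventually.of_forall fun p => rfl
  | succ j ih =>
    have hm : j + 1 ∈ Finset.Icc 1 n := Finset.mem_Icc.2 ⟨by omega, hj⟩
    have h1 := (analyticAt_step (hD.analytic_T _ hm) (hD.analytic_S _ hm) hx).continuousAt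
    have h2 : Tendsto (fun p : (Angle l × Slow m) × ℝ => (D.step (j + 1) p.2 p.1, p.2))
        (𝓝 (x, 0)) (𝓝 (x, 0)) := by
      have := (h1.prodMk continuousAt_snd).tendsto
      simp only at this
      rwa [step_zero (by omega)] at this
    filter_upwards [h2.eventually (ih (by omega)), hD.eventually_conj hM hm hx] with p hp1 hp2
    simp only [hInv, Function.comp_apply] at hp1 ⊢
    rw [hp1, hp2]

theorem analyticAt_normalForm_last (hD : D.IsDecoupling ω₀ M F G n) {x : Angle l × Slow m}
    (hx : x ∈ (univ : Set (Angle l)) ×ˢ M) :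
    AnalyticAt ℝ (fun p : (Angle l × Slow m) × ℝ => D.normalForm ω₀ (n + 1) p.2 p.1) (x, 0) :=
  analyticAt_normalForm hD.analytic_F hD.analytic_G (by omega) hx

theorem normalForm_last_add_latticeShift (hD : D.IsDecoupling ω₀ M F G n) (κ : ℝ)
    (x : Angle l × Slow m) (k : Fin l → ℤ) :
    D.normalForm ω₀ (n + 1) κ (x + latticeShift k)
      = D.normalForm ω₀ (n + 1) κ x + latticeShift k :=
  have hm : n + 1 ∈ Finset.Icc 1 (n + 1) := Finset.mem_Icc.2 ⟨by omega, le_rfl⟩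
  normalForm_add_latticeShift (hD.analytic_F _ hm) (hD.analytic_G _ hm) κ x k

/-- For small `κ` the map `hInv` conjugates uniformly on (torus) × `C`, and is an analytic map into
(torus) × `M` that is close to the identity. -/
theorem eventually_hInv (hD : D.IsDecoupling ω₀ M F G n) (hM : IsOpen M) {C : Set (Slow m)}
    (hC : IsCompact C) (hCM : C ⊆ M) :
    ∀ᶠ κ in 𝓝 (0 : ℝ),
      (∀ x ∈ (univ : Set (Angle l)) ×ˢ C, AnalyticAt ℝ (D.hInv n κ) x ∧ (D.hInv n κ x).2 ∈ M ∧
        D.normalForm ω₀ 1 κ (D.hInv n κ x) = D.hInv n κ (D.normalForm ω₀ (n + 1) κ x)) ∧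
      ∀ x ∈ (univ : Set (Angle l)) ×ˢ C, ∀ y ∈ (univ : Set (Angle l)) ×ˢ C,
        ‖(D.hInv n κ x - x) - (D.hInv n κ y - y)‖ ≤ 1 / 2 * ‖x - y‖ := by
  have hsub : ∀ x ∈ (univ : Set (Angle l)) ×ˢ C, x ∈ (univ : Set (Angle l)) ×ˢ M :=
    fun x hx => ⟨hx.1, hCM hx.2⟩
  have hper := fun κ x k => hD.hInv_add_latticeShift le_rfl κ x k
  refine (eventually_forall_torus hC (fun x κ k h => ?_) fun x hx => ?_).and
    (eventually_lipschitz_torus (H := fun p => D.hInv n p.2 p.1) hC (fun x => hInv_zero n x)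
      (fun x κ k => hper κ x k) fun x hx => hD.analyticAt_hInv le_rfl (hsub x hx))
  · obtain ⟨h1, h2, h3⟩ := h
    refine ⟨?_, ?_, ?_⟩
    · have h4 : AnalyticAt ℝ (fun y => D.hInv n κ (y + latticeShift k) - latticeShift k) x :=
        (h1.fun_comp (f := fun y => y + latticeShift k) (x := x)
          (analyticAt_id.add analyticAt_const)).sub analyticAt_const
      simpa only [hper, add_sub_cancel_right] using h4
    · rw [hper] at h2
      simpa [latticeShift] using h2
    · have hD1 : 1 ∈ Finset.Icc 1 (n + 1) := Finset.mem_Icc.2 ⟨le_rfl, by omega⟩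
      rw [hper, normalForm_add_latticeShift (hD.analytic_F _ hD1) (hD.analytic_G _ hD1),
        hD.normalForm_last_add_latticeShift, hper] at h3
      exact add_right_cancel h3
  · have ha := hD.analyticAt_hInv le_rfl (hsub x hx)
    have h2 : ∀ᶠ p in 𝓝 (x, (0 : ℝ)), (D.hInv n p.2 p.1).2 ∈ M := by
      refine (continuousAt_snd.comp ha.continuousAt).eventually (hM.mem_nhds ?_)
      simpa [hInv_zero] using hCM hx.2
    filter_upwards [ha.eventually_analyticAt, h2, hD.eventually_conj_hInv hM le_rfl (hsub x hx)]
      with p hp1 hp2 hp3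
    refine ⟨?_, hp2, hp3⟩
    exact hp1.fun_comp (f := fun y => (y, p.2)) (analyticAt_id.prod analyticAt_const)

/-- One step of the decoupled map, corrected by the generator of the next decoupling
transformation, agrees with one step of the averaged map up to `O(κ ^ (n + 2))`. -/
theorem exists_step_estimate (hD : D.IsDecoupling ω₀ M F G n) (hω₀ : IsDiophantine ω₀)
    {C : Set (Slow m)} (hC : IsCompact C) (hCM : C ⊆ M) :
    ∃ S : Angle l × Slow m → Slow m, ∃ L Λ : ℝ, 0 ≤ L ∧ 0 ≤ Λ ∧ ∀ᶠ κ in 𝓝 (0 : ℝ), 0 < κ →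
      ∀ x ∈ (univ : Set (Angle l)) ×ˢ C, ‖S x‖ ≤ L ∧ ‖S (D.normalForm ω₀ (n + 1) κ x)‖ ≤ L ∧
      ∀ I ∈ C, ‖((D.normalForm ω₀ (n + 1) κ x).2 - D.averagedMap (n + 1) κ I
          - κ ^ (n + 1) • S (D.normalForm ω₀ (n + 1) κ x)) - (x.2 - I - κ ^ (n + 1) • S x)‖
        ≤ κ * Λ * ‖x.2 - I‖ + κ ^ (n + 1) * (κ * L) := by
  have hm : n + 1 ∈ Finset.Icc 1 (n + 1) := Finset.mem_Icc.2 ⟨by omega, le_rfl⟩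
  have hFa := hD.analytic_F _ hm
  have hGa := hD.analytic_G _ hm
  have hsub : ∀ x ∈ (univ : Set (Angle l)) ×ˢ C, x ∈ (univ : Set (Angle l)) ×ˢ M :=
    fun x hx => ⟨hx.1, hCM hx.2⟩
  -- This `S` is an auxiliary function, independent of the generators in `D`, whose conditions as a
  -- decoupling sequence stop at index n.
  obtain ⟨S, hS, hSc⟩ := hω₀.exists_cohomological_solution hGa.isAnalyticOnTorus
  set s : Angle l × Slow m → Slow m := fun x => S x.1 x.2 with hs
  have hsper : ∀ x (k : Fin l → ℤ), s (x + latticeShift k) = s x := by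
    intro x k
    have h := hS.1 x.2 x.1 k
    simp only at h
    simp only [hs, latticeShift, Prod.fst_add, Prod.snd_add, add_zero, h]
  have hsN : ∀ x ∈ (univ : Set (Angle l)) ×ˢ C, AnalyticAt ℝ
      (fun p : (Angle l × Slow m) × ℝ => s (D.normalForm ω₀ (n + 1) p.2 p.1)) (x, 0) := by
    intro x hx
    refine AnalyticAt.fun_comp (g := s) ?_ (hD.analyticAt_normalForm_last (hsub x hx))
    rw [normalForm_zero (by omega)]
    exact hS.2 _ ⟨mem_univ _, by simpa using hCM hx.2⟩
  have hsNper : ∀ x κ (k : Fin l → ℤ), s (D.normalForm ω₀ (n + 1) κ (x + latticeShift k))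
      = s (D.normalForm ω₀ (n + 1) κ x) := fun x κ k => by
    rw [hD.normalForm_last_add_latticeShift, hsper]
  have hrem : ∀ x ∈ (univ : Set (Angle l)) ×ˢ C, AnalyticAt ℝ
      (fun p : (Angle l × Slow m) × ℝ => (D.remainder (n + 1) p).2) (x, 0) := fun x hx =>
    analyticAt_snd.comp (analyticAt_remainder hFa hGa (hsub x hx))
  obtain ⟨B₁, hB₁⟩ := eventually_bound_torus hC (f := fun p => s p.1) (fun x _ k => hsper x k)
    fun x hx => ContinuousAt.comp (g := s) (x := (x, (0 : ℝ)))
      (hS.2 x (hsub x hx)).continuousAt continuousAt_fst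
  obtain ⟨B₂, hB₂⟩ := eventually_bound_torus hC
    (f := fun p => s (D.normalForm ω₀ (n + 1) p.2 p.1)) hsNper
    fun x hx => (hsN x hx).continuousAt
  obtain ⟨B₃, hB₃⟩ := eventually_bound_sub_torus hC
    (f := fun p => s (D.normalForm ω₀ (n + 1) p.2 p.1)) hsNper hsN
  obtain ⟨B₄, hB₄⟩ := eventually_bound_sub_torus hC
    (f := fun p => (D.remainder (n + 1) p).2)
    (fun x κ k => by rw [remainder_add_latticeShift hFa hGa]) hrem
  have hlip : ∀ j, ∃ L : ℝ, 0 ≤ L ∧ (j ∈ Finset.Icc 1 (n + 1) → ∀ x ∈ C, ∀ y ∈ C,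
      ‖angleAverage (D.G j) x - angleAverage (D.G j) y‖ ≤ L * ‖x - y‖) := by
    intro j
    by_cases hj : j ∈ Finset.Icc 1 (n + 1)
    · obtain ⟨L, hL, h⟩ := exists_lipschitz_of_analyticOnNhd hC
        ((hD.analytic_G j hj).analyticOnNhd_angleAverage.mono hCM)
      exact ⟨L, hL, fun _ => h⟩
    · exact ⟨0, le_rfl, fun h => absurd h hj⟩
  choose Λ hΛ0 hΛ using hlip
  set L : ℝ := max (max B₁ B₂) (max (B₃ + B₄) 0) with hL
  have hL0 : 0 ≤ L := (le_max_right _ _).trans (le_max_right _ _)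
  have hL1 : B₁ ≤ L := (le_max_left _ _).trans (le_max_left _ _)
  have hL2 : B₂ ≤ L := (le_max_right _ _).trans (le_max_left _ _)
  have hL3 : B₃ + B₄ ≤ L := (le_max_left _ _).trans (le_max_right _ _)
  have hκ1 : ∀ᶠ κ in 𝓝 (0 : ℝ), κ < 1 := eventually_lt_nhds one_pos
  refine ⟨s, L, ∑ j ∈ Finset.Icc 1 (n + 1), Λ j, hL0, Finset.sum_nonneg fun j _ => hΛ0 j, ?_⟩
  filter_upwards [hB₁, hB₂, hB₃, hB₄, hκ1] with κ h1 h2 h3 h4 hκ1 hκ x hx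
  refine ⟨(h1 x hx).trans hL1, (h2 x hx).trans hL2, fun I hI => ?_⟩
  have h3x := h3 x hx
  have h4x := h4 x hx
  rw [abs_of_pos hκ] at h3x h4x
  rw [normalForm_zero (by omega)] at h3x
  have hcoh : angleAverage (D.G (n + 1)) x.2
      = (D.remainder (n + 1) (x, 0)).2 - (s (x + (ω₀, 0)) - s x) := by
    have h := hSc x.2 (hCM hx.2) x.1
    simp only [hs, Prod.fst_add, Prod.snd_add, add_zero, h, remainder, angleAverage]
    abel
  have hNF2 : (D.normalForm ω₀ (n + 1) κ x).2 = x.2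
      + ∑ j ∈ Finset.Ico 1 (n + 1), κ ^ j • angleAverage (D.G j) x.2
      + κ ^ (n + 1) • (D.remainder (n + 1) (x, κ)).2 := rfl
  have hsum : ∀ u : Slow m, ∑ j ∈ Finset.Icc 1 (n + 1), κ ^ j • angleAverage (D.G j) u
      = ∑ j ∈ Finset.Ico 1 (n + 1), κ ^ j • angleAverage (D.G j) u
        + κ ^ (n + 1) • angleAverage (D.G (n + 1)) u := by
    intro u
    rw [← Finset.sum_Ico_succ_top (by omega)]
    rfl
  -- The order n+1 oscillation at κ = 0 cancels against the coboundary. What remains is a difference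
  -- of averaged terms, Lipschitz in the slow error, and two variations from κ = 0, each O(κ),
  -- carrying the prefactor κ^(n+1).
  have hid : ((D.normalForm ω₀ (n + 1) κ x).2 - D.averagedMap (n + 1) κ I
          - κ ^ (n + 1) • s (D.normalForm ω₀ (n + 1) κ x)) - (x.2 - I - κ ^ (n + 1) • s x)
      = ∑ j ∈ Finset.Icc 1 (n + 1), κ ^ j •
          (angleAverage (D.G j) x.2 - angleAverage (D.G j) I)
        + κ ^ (n + 1) • (((D.remainder (n + 1) (x, κ)).2 - (D.remainder (n + 1) (x, 0)).2)
          - (s (D.normalForm ω₀ (n + 1) κ x) - s (x + (ω₀, 0)))) := by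
    simp only [smul_sub, Finset.sum_sub_distrib]
    rw [hsum x.2, hcoh, averagedMap]
    nth_rewrite 1 [hNF2]
    module
  rw [hid]
  refine (norm_add_le _ _).trans (add_le_add ?_ ?_)
  · rw [mul_assoc, Finset.sum_mul, Finset.mul_sum]
    refine norm_sum_le_of_le _ fun j hj => ?_
    rw [norm_smul, norm_pow, Real.norm_eq_abs, abs_of_pos hκ]
    have hj1 : j ≠ 0 := by have := (Finset.mem_Icc.1 hj).1; omega
    exact mul_le_mul (pow_le_of_le_one hκ.le hκ1.le hj1) (hΛ j hj _ hx.2 _ hI) (norm_nonneg _) hκ.le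
  · rw [norm_smul, norm_pow, Real.norm_eq_abs, abs_of_pos hκ]
    refine mul_le_mul_of_nonneg_left ?_ (by positivity)
    refine (norm_sub_le _ _).trans ?_
    nlinarith

end IsDecoupling

end DecouplingData

end SlowFast

/-! ### Shadowing of averaged orbits over times of order 1/κ. -/

namespace SlowFast

variable {l m : ℕ}

namespace DecouplingData.IsDecoupling

variable {D : DecouplingData l m} {ω₀ : Angle l} {M : Set (Slow m)}
  {F : Angle l → Slow m → ℝ → Angle l} {G : Angle l → Slow m → ℝ → Slow m} {n : ℕ}

/-- Orbits of the decoupled map shadow orbits of the averaged map of order `n + 1` up to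
`O(κ ^ (n + 1))`, over times of order `1 / κ`. -/
theorem exists_shadowing (hD : D.IsDecoupling ω₀ M F G n) (hω₀ : IsDiophantine ω₀)
    {V : Set (Slow m)} (hV : IsOpen V) (hVc : IsCompact (closure V)) (hVM : closure V ⊆ M)
    {K : Set (Slow m)} (hK : IsCompact K) (hKV : K ⊆ V) {T : ℝ} :
    ∃ C : ℝ, ∀ᶠ κ in 𝓝 (0 : ℝ), 0 < κ → ∀ y ∈ (univ : Set (Angle l)) ×ˢ V,
      (∀ t : ℕ, (t : ℝ) < T / κ → (D.averagedMap (n + 1) κ)^[t] y.2 ∈ K) →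
      ∀ t : ℕ, (t : ℝ) < T / κ → (D.normalForm ω₀ (n + 1) κ)^[t] y ∈ (univ : Set (Angle l)) ×ˢ V ∧
        ‖((D.normalForm ω₀ (n + 1) κ)^[t] y).2 - (D.averagedMap (n + 1) κ)^[t] y.2‖
          ≤ C * κ ^ (n + 1) := by
  obtain ⟨S, L, Λ, hL, hΛ, hev⟩ := hD.exists_step_estimate hω₀ hVc hVM
  obtain ⟨δ, hδ, hδV⟩ := hK.exists_thickening_subset_open hV hKV
  -- The true slow error exceeds the corrected one by at most κ^(n+1) L, so the corrected error
  -- obeys e' ≤ (1 + κΛ) e + κ c κ^(n+1), with initial value at most κ^(n+1) L. The final +L in `C`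
  -- restores the correction.
  set c := Λ * L + L with hc
  have hc0 : 0 ≤ c := by positivity
  set C := Real.exp (Λ * T) * (L + T * c) + L with hC
  have hsmall : ∀ᶠ κ in 𝓝 (0 : ℝ), C * κ ^ (n + 1) < δ := by
    have h : ContinuousAt (fun κ : ℝ => C * κ ^ (n + 1)) 0 := by fun_prop
    exact h.tendsto.eventually_lt_const (by simpa using hδ)
  refine ⟨C, ?_⟩
  filter_upwards [hev, hsmall] with κ hκ hκδ hκ0 y hy hK'
  specialize hκ hκ0
  set N := D.normalForm ω₀ (n + 1) κ with hN
  set A := D.averagedMap (n + 1) κ with hA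
  have hpow : 0 ≤ κ ^ (n + 1) := by positivity
  have hfinal : ∀ t : ℕ, (t : ℝ) < T / κ → ‖S (N^[t] y)‖ ≤ L →
      ‖(N^[t] y).2 - A^[t] y.2 - κ ^ (n + 1) • S (N^[t] y)‖
        ≤ (1 + κ * Λ) ^ t * (L + t * (κ * c)) * κ ^ (n + 1) →
      N^[t] y ∈ (univ : Set (Angle l)) ×ˢ V ∧ ‖(N^[t] y).2 - A^[t] y.2‖ ≤ C * κ ^ (n + 1) := by
    intro t ht hS he
    have h1 : ‖(N^[t] y).2 - A^[t] y.2‖ ≤ C * κ ^ (n + 1) := by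
      have h2 := gronwall_growth hΛ hκ0 hL hc0 ht
      have h3 : ‖κ ^ (n + 1) • S (N^[t] y)‖ ≤ κ ^ (n + 1) * L := by
        rw [norm_smul, Real.norm_of_nonneg hpow]
        exact mul_le_mul_of_nonneg_left hS hpow
      have h4 := norm_sub_norm_le ((N^[t] y).2 - A^[t] y.2) (κ ^ (n + 1) • S (N^[t] y))
      have h5 := mul_le_mul_of_nonneg_right h2 hpow
      rw [hC, add_mul]
      linarith
    refine ⟨⟨mem_univ _, hδV ?_⟩, h1⟩
    refine Metric.mem_thickening_iff.2 ⟨_, hK' t ht, ?_⟩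
    rw [dist_eq_norm]
    exact h1.trans_lt hκδ
  -- Bootstrap: a step estimate needs the current point in V, and the resulting bound, being less
  -- than δ, puts the next point within the δ-thickening of K and so in V.
  have hmain : ∀ t : ℕ, (t : ℝ) < T / κ → N^[t] y ∈ (univ : Set (Angle l)) ×ˢ V ∧
      ‖S (N^[t] y)‖ ≤ L ∧ ‖(N^[t] y).2 - A^[t] y.2 - κ ^ (n + 1) • S (N^[t] y)‖
        ≤ (1 + κ * Λ) ^ t * (L + t * (κ * c)) * κ ^ (n + 1) := by
    intro t
    induction t with
    | zero =>
      intro ht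
      have h1 := (hκ y ⟨hy.1, subset_closure hy.2⟩).1
      refine ⟨hy, h1, ?_⟩
      simp only [Function.iterate_zero, id, sub_self, zero_sub, norm_neg, pow_zero, one_mul,
        Nat.cast_zero, zero_mul, add_zero]
      rw [norm_smul, Real.norm_of_nonneg hpow, mul_comm]
      exact mul_le_mul_of_nonneg_right h1 hpow
    | succ t ih =>
      intro ht
      have ht' : (t : ℝ) < T / κ := by push_cast at ht; linarith
      obtain ⟨h1, h2, h3⟩ := ih ht'
      obtain ⟨-, h4, h5⟩ := hκ _ ⟨h1.1, subset_closure h1.2⟩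
      have h6 := h5 _ (subset_closure (hKV (hK' t ht')))
      rw [← Function.iterate_succ_apply' N, ← Function.iterate_succ_apply' A] at h6
      rw [← Function.iterate_succ_apply' N] at h4
      have h7 : ‖(N^[t] y).2 - A^[t] y.2‖ ≤
          ‖(N^[t] y).2 - A^[t] y.2 - κ ^ (n + 1) • S (N^[t] y)‖ + κ ^ (n + 1) * L := by
        have h8 := norm_sub_norm_le ((N^[t] y).2 - A^[t] y.2) (κ ^ (n + 1) • S (N^[t] y))
        have h9 : ‖κ ^ (n + 1) • S (N^[t] y)‖ ≤ κ ^ (n + 1) * L := by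
          rw [norm_smul, Real.norm_of_nonneg hpow]
          exact mul_le_mul_of_nonneg_left h2 hpow
        linarith
      set e := ‖(N^[t] y).2 - A^[t] y.2 - κ ^ (n + 1) • S (N^[t] y)‖ with he
      have h10 : ‖(N^[t + 1] y).2 - A^[t + 1] y.2 - κ ^ (n + 1) • S (N^[t + 1] y)‖
          ≤ (1 + κ * Λ) ^ (t + 1) * (L + (t + 1 : ℕ) * (κ * c)) * κ ^ (n + 1) := by
        have h11 := norm_sub_norm_le
          ((N^[t + 1] y).2 - A^[t + 1] y.2 - κ ^ (n + 1) • S (N^[t + 1] y))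
          ((N^[t] y).2 - A^[t] y.2 - κ ^ (n + 1) • S (N^[t] y))
        have h12 : κ * Λ * ‖(N^[t] y).2 - A^[t] y.2‖ ≤ κ * Λ * (e + κ ^ (n + 1) * L) :=
          mul_le_mul_of_nonneg_left h7 (by positivity)
        have hq : 1 ≤ (1 + κ * Λ) ^ (t + 1) := one_le_pow₀ (by nlinarith)
        calc _ ≤ (1 + κ * Λ) * e + κ * c * κ ^ (n + 1) := by rw [hc]; linarith
          _ ≤ (1 + κ * Λ) * ((1 + κ * Λ) ^ t * (L + t * (κ * c)) * κ ^ (n + 1))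
              + (1 + κ * Λ) ^ (t + 1) * (κ * c * κ ^ (n + 1)) := by
            exact add_le_add (mul_le_mul_of_nonneg_left h3 (by positivity))
              (le_mul_of_one_le_left (by positivity) hq)
          _ = _ := by push_cast; ring
      exact ⟨(hfinal _ ht h4 h10).1, h4, h10⟩
  intro t ht
  obtain ⟨-, h2, h3⟩ := hmain t ht
  exact hfinal t ht h2 h3

end DecouplingData.IsDecoupling

end SlowFast

/-! ### Assembly of existence and error estimate. -/

theorem mainTheorem5 {l m : ℕ} (n : ℕ) (hn : 1 ≤ n)
    (ω₀ : SlowFast.Angle l) (hω₀ : SlowFast.IsDiophantine ω₀)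
    (M : Set (SlowFast.Slow m)) (hM : IsOpen M)
    (F : SlowFast.Angle l → SlowFast.Slow m → ℝ → SlowFast.Angle l)
    (G : SlowFast.Angle l → SlowFast.Slow m → ℝ → SlowFast.Slow m)
    (hF : SlowFast.IsAnalyticFamily M F) (hG : SlowFast.IsAnalyticFamily M G) :
    (∃ D : SlowFast.DecouplingData l m, D.IsDecoupling ω₀ M F G n) ∧
    ∀ D : SlowFast.DecouplingData l m, D.IsDecoupling ω₀ M F G n →
      ∀ V : Set (SlowFast.Slow m), IsOpen V → IsCompact (closure V) → closure V ⊆ M →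
      ∀ K : Set (SlowFast.Slow m), IsCompact K → K ⊆ V →
      ∀ T : ℝ, 0 < T →
      ∃ κ₀ > 0, ∃ C : ℝ,
        (∀ κ : ℝ, |κ| < κ₀ →
          Set.InjOn (D.hInv n κ) (Set.univ ×ˢ V) ∧
          IsOpen (D.hInv n κ '' (Set.univ ×ˢ V)) ∧
          AnalyticOnNhd ℝ (D.hInv n κ) (Set.univ ×ˢ V) ∧
          AnalyticOnNhd ℝ (D.h n V κ) (D.hInv n κ '' (Set.univ ×ˢ V))) ∧
        ∀ κ : ℝ, 0 < κ → κ < κ₀ →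
          ∀ x₀ ∈ D.hInv n κ '' (Set.univ ×ˢ V), ∀ I₀ : SlowFast.Slow m,
            I₀ = (D.h n V κ x₀).2 →
            (∀ t : ℕ, (t : ℝ) < T / κ → (D.averagedMap (n + 1) κ)^[t] I₀ ∈ K) →
            ∀ t : ℕ, (t : ℝ) < T / κ →
              ((SlowFast.slowFastMap ω₀ F G κ)^[t] x₀).2 ∈ M ∧
              (SlowFast.slowFastMap ω₀ F G κ)^[t] x₀ ∈ D.hInv n κ '' (Set.univ ×ˢ V) ∧
              ‖(D.h n V κ ((SlowFast.slowFastMap ω₀ F G κ)^[t] x₀)).2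
                - (D.averagedMap (n + 1) κ)^[t] I₀‖ ≤ C * κ ^ (n + 1) := by
  refine ⟨SlowFast.DecouplingData.exists_isDecoupling hω₀ hM hF hG n,
    fun D hD V hV hVc hVM K hK hKV T hT => ?_⟩
  obtain ⟨C, hC⟩ := hD.exists_shadowing hω₀ hV hVc hVM hK hKV (T := T)
  obtain ⟨κ₀, hκ₀, hball⟩ := Metric.eventually_nhds_iff.1 ((hD.eventually_hInv hM hVc hVM).and hC)
  have hsub : ∀ x ∈ (Set.univ : Set (SlowFast.Angle l)) ×ˢ V,
      x ∈ (Set.univ : Set (SlowFast.Angle l)) ×ˢ closure V := fun x hx => ⟨hx.1, subset_closure hx.2⟩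
  have hdiff : ∀ κ : ℝ, |κ| < κ₀ → _ := fun κ hκ =>
    SlowFast.analytic_diffeomorphism_of_near_identity (N := Set.univ ×ˢ V) (φ := D.hInv n κ)
      (isOpen_univ.prod hV)
      (fun x hx => ((hball (by simpa using hκ)).1.1 x (hsub x hx)).1)
      (fun x hx y hy => (hball (by simpa using hκ)).1.2 x (hsub x hx) y (hsub y hy))
  refine ⟨κ₀, hκ₀, C, fun κ hκ => ?_, ?_⟩
  · obtain ⟨h1, h2, h3⟩ := hdiff κ hκ
    exact ⟨h1, h2, fun x hx => ((hball (by simpa using hκ)).1.1 x (hsub x hx)).1, h3⟩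
  · rintro κ hκ hκκ₀ _ ⟨y, hy, rfl⟩ I₀ hI₀ hK' t ht
    have habs : |κ| < κ₀ := by rwa [abs_of_pos hκ]
    obtain ⟨⟨hloc, -⟩, hshadow⟩ := hball (y := κ) (by simpa using habs)
    have hinv : ∀ z ∈ (Set.univ : Set (SlowFast.Angle l)) ×ˢ V, D.h n V κ (D.hInv n κ z) = z :=
      (hdiff κ habs).1.leftInvOn_invFunOn
    rw [hinv y hy] at hI₀
    subst hI₀
    have horbit := hshadow hκ y hy hK'
    -- The conjugacy is available only over the closure of V, so the shadowing result, which
    -- confines the decoupled orbit to V, has to come first.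
    have hconj : ∀ t : ℕ, (t : ℝ) < T / κ → (SlowFast.slowFastMap ω₀ F G κ)^[t] (D.hInv n κ y)
        = D.hInv n κ ((D.normalForm ω₀ (n + 1) κ)^[t] y) := by
      intro t
      induction t with
      | zero => intro _; rfl
      | succ t ih =>
        intro ht
        have ht' : (t : ℝ) < T / κ := by push_cast at ht; linarith
        rw [Function.iterate_succ_apply', ih ht', hD.slowFastMap_eq,
          (hloc _ (hsub _ (horbit t ht').1)).2.2,
          ← Function.iterate_succ_apply' (D.normalForm ω₀ (n + 1) κ)]
    obtain ⟨h1, h2⟩ := horbit t ht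
    rw [hconj t ht]
    refine ⟨(hloc _ (hsub _ h1)).2.1, ⟨_, h1, rfl⟩, ?_⟩
    rw [hinv _ h1]
    exact h2
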